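/- Let $\mathbb K$ be a field of characteristic zero, $V=\mathbb K^3$ and $S=\mathbb K[x,y,z]$. Let $\mathcal A$ be a projective line arrangement, i.e. a finite set of lines in $\mathbf P^2_{\mathbb K}$ (linear planes $H=\ker\alpha_H\subset V$) which is essential: $\bigcap_{H\in\mathcal A}H=\{0\}$. A *point* of $\mathcal A$ is an intersection of members of $\mathcal A$ of codimension $2$ in $V$; let $L_2(\mathcal A)$ be the set of points, $\mathcal A_p=\{H\in\mathcal A\mid p\in H\}$ and $\mu(p)=|\mathcal A_p|-1$ for $p\in L_2(\mathcal A)$, and let $n_2(\mathcal A)=|\{p\in L_2(\mathcal A)\mid \mu(p)=1\}|$ be the number of double points. For $H\in\mathcal A$ let $\mathcal A^H=\{H\cap L\mid L\in\mathcal A\setminus\{H\}\}$, and for $p\in\mathcal A^H$ let $m^H(p)=|\{L\in\mathcal A\setminus\{H\}\mid L\cap H=p\}|$. For any finite set $\mathcal B$ of lines let $D(\mathcal B)=\{\theta\in\operatorname{Der}S\mid \theta(\alpha_H)\in S\alpha_H\ \text{for all } H\in\mathcal B\}$. Then $\mathcal B$ is *free* if $D(\mathcal B)$ has an $S$-basis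 consisting of the Euler derivation $\theta_E=x\partial_x+y\partial_y+z\partial_z$ and two homogeneous derivations (where $\theta$ is homogeneous of degree $d$ if $\theta(x),\theta(y),\theta(z)\in S_d$). For $H\in\mathcal A$ put $D_H(\mathcal A)=\{\theta\in D(\mathcal A)\mid\theta(\alpha_H)=0\}$, and let $\mathrm{mdr}(\mathcal A)$ be the least $d$ such that $D_H(\mathcal A)$ has a nonzero homogeneous element of degree $d$; it does not depend on $H\in\mathcal A$. The arrangement $\mathcal A$ is *supersolvable* if there is a point $p\in L_2(\mathcal A)$ such that for all distinct $H,L\in\mathcal A\setminus\mathcal A_p$ there is a unique $K\in\mathcal A_p$ with $H\cap L\subset K$. It is *nearly supersolvable* if it is not supersolvable but $\mathcal A=\mathcal B\setminus\{H\}$ for some supersolvable projective line arrangement $\mathcal B$ and some $H\in\mathcal B$. It is *divisionally free* if $\chi_0(\mathcal A;|\mathcal A^H|-1)=0$ for some $H\in\mathcal A$, where $\chi_0(\mathcal A;t)=t^2-(|\mathcal A|-1)t+\sum_{q\in L_2(\mathcal A)}\mu(q)-|\mathcal A|+1$. *Inductive freeness* of central arrangements in finite-dimensional vector spaces is defined recursively: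 the empty arrangement in $\mathbb K^\ell$ is inductively free with multiset of exponents $\{0^\ell\}$, and if for some member $H$ of an arrangement the deletion of $H$ is inductively free with exponents $E\cup\{b\}$ and the restriction to $H$ is inductively free with exponents $E$, then the arrangement is inductively free with exponents $E\cup\{b+1\}$. **Theorem.** Let $\mathcal A$ be a projective line arrangement over a field of characteristic zero. Then $n_2(\mathcal A)>0$ if at least one of the following conditions holds: 1. $\mathcal A$ has a generic line, i.e. there is $H\in\mathcal A$ such that every point of $\mathcal A$ on $H$ is a double point; 2. $\mathcal A$ is supersolvable or nearly supersolvable; 3. there is $H\in\mathcal A$ such that $\mathcal A\setminus\{H\}$ is free; the conclusion holds in particular if $\mathcal A$ is inductively free or divisionally free; 4. there are $H\in\mathcal A$ and $p\in\mathcal A^H$ such that $m^H(p)\ge|\mathcal A|/2$; 5. there is $H\in\mathcal A$ such that $|\mathcal A^H|>\mathrm{mdr}(\mathcal A)$. -/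

import Mathlib

universe u

noncomputable section

namespace LineArrangement

open MvPolynomial

/-! ### Arrangements, restrictions and inductive freeness -/

/-- The restriction of an arrangement `A` in `V` to its member `H`: the arrangement in the vector
space `H` formed by the intersections `H ∩ L` with `L ∈ A`, `L ≠ H`. -/
def restrictionIn {K : Type*} [Field K] {V : Type*} [AddCommGroup V] [Module K V]
    (A : Set (Submodule K V)) (H : Submodule K V) : Set (Submodule K H) :=
  {X | ∃ L ∈ A, L ≠ H ∧ X = L.comap H.subtype}

/-- `InductivelyFreeWith K V A E`: the central hyperplane arrangement `A` in the vector space `V` is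
inductively free with multiset of exponents `E`. The empty arrangement is inductively free with exponents
`0, …, 0` (`dim V` of them); if `H ∈ A`, the deletion `A \ {H}` is inductively free with
exponents `b, E` and the restriction to `H` is inductively free with exponents `E`, then `A` is
inductively free with exponents `b + 1, E`. -/
inductive InductivelyFreeWith (K : Type u) [Field K] :
    (V : Type u) → [AddCommGroup V] → [Module K V] → Set (Submodule K V) → Multiset ℕ → Prop
  | empty (V : Type u) [AddCommGroup V] [Module K V] :
      InductivelyFreeWith K V ∅ (Multiset.replicate (Module.finrank K V) 0)
  | addition (V : Type u) [AddCommGroup V] [Module K V] (A : Set (Submodule K V))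
      (H : Submodule K V) (b : ℕ) (E : Multiset ℕ) (hH : H ∈ A)
      (hdel : InductivelyFreeWith K V (A \ {H}) (b ::ₘ E))
      (hres : InductivelyFreeWith K H (restrictionIn A H) E) :
      InductivelyFreeWith K V A ((b + 1) ::ₘ E)

variable {K : Type u} [Field K]

/-- `A` is inductively free. -/
def IsInductivelyFree (A : Set (Submodule K (Fin 3 → K))) : Prop :=
  ∃ E : Multiset ℕ, InductivelyFreeWith K (Fin 3 → K) A E

/-! ### Combinatorics of line arrangements in the projective plane

A line in the projective plane over `K` is a linear plane in `K ^ 3`, and a point is a linear line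
in `K ^ 3`. -/

/-- The intersection lattice: all intersections of subfamilies of `A` (the empty intersection being
the whole space). -/
def lattice (A : Set (Submodule K (Fin 3 → K))) : Set (Submodule K (Fin 3 → K)) :=
  {X | ∃ B ⊆ A, X = sInf B}

/-- A projective line arrangement: a finite set of linear planes in `K ^ 3` which is essential, i.e.
the origin is in the intersection lattice. -/
structure IsProjectiveLineArrangement (A : Set (Submodule K (Fin 3 → K))) : Prop where
  finite : A.Finite
  finrank_eq_two : ∀ H ∈ A, Module.finrank K H = 2
  essential : ⊥ ∈ lattice A

/-- The points of `A`: the members of the intersection lattice of codimension two in `K ^ 3`. -/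
def points (A : Set (Submodule K (Fin 3 → K))) : Set (Submodule K (Fin 3 → K)) :=
  {X | X ∈ lattice A ∧ Module.finrank K X = 1}

/-- The subarrangement `A_p` of the lines through `p`. -/
def through (A : Set (Submodule K (Fin 3 → K))) (p : Submodule K (Fin 3 → K)) :
    Set (Submodule K (Fin 3 → K)) :=
  {H | H ∈ A ∧ p ≤ H}

/-- `μ(p)`: the number of lines of `A` through `p`, minus one. -/
def mu (A : Set (Submodule K (Fin 3 → K))) (p : Submodule K (Fin 3 → K)) : ℤ :=
  ((through A p).ncard : ℤ) - 1

/-- `n₂(A)`: the number of double points. -/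
def n2 (A : Set (Submodule K (Fin 3 → K))) : ℕ :=
  {p | p ∈ points A ∧ mu A p = 1}.ncard

/-- The set `A^H` of the points `H ∩ L`, `L ∈ A \ {H}`. -/
def restriction (A : Set (Submodule K (Fin 3 → K))) (H : Submodule K (Fin 3 → K)) :
    Set (Submodule K (Fin 3 → K)) :=
  {X | ∃ L ∈ A \ {H}, X = H ⊓ L}

/-- The multiplicity `m^H(X)`: the number of `L ∈ A \ {H}` with `L ∩ H = X`. -/
def multiplicity (A : Set (Submodule K (Fin 3 → K))) (H X : Submodule K (Fin 3 → K)) : ℕ :=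
  {L | L ∈ A \ {H} ∧ L ⊓ H = X}.ncard

/-- A generic line of `A`: a member all of whose points are double points. -/
def IsGenericLine (A : Set (Submodule K (Fin 3 → K))) (H : Submodule K (Fin 3 → K)) : Prop :=
  H ∈ A ∧ ∀ p ∈ points A, p ≤ H → mu A p = 1

/-- `p` is a modular point of `A`. -/
def IsModularPoint (A : Set (Submodule K (Fin 3 → K))) (p : Submodule K (Fin 3 → K)) : Prop :=
  p ∈ points A ∧
    ∀ H ∈ A \ through A p, ∀ L ∈ A \ through A p, H ≠ L → ∃! M, M ∈ through A p ∧ H ⊓ L ≤ M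

/-- `A` is supersolvable: it has a modular point. -/
def IsSupersolvable (A : Set (Submodule K (Fin 3 → K))) : Prop :=
  ∃ p, IsModularPoint A p

/-- `A` is nearly supersolvable: it is not supersolvable, but it is obtained from a supersolvable
line arrangement by deleting a line. -/
def IsNearlySupersolvable (A : Set (Submodule K (Fin 3 → K))) : Prop :=
  ¬ IsSupersolvable A ∧
    ∃ B, IsProjectiveLineArrangement B ∧ IsSupersolvable B ∧ ∃ H ∈ B, A = B \ {H}

/-- The value at `t` of the characteristic polynomial
`χ₀(A; t) = t² - (|A| - 1) t + (∑_q μ(q)) - |A| + 1`. -/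
def chi0 (A : Set (Submodule K (Fin 3 → K))) (t : ℤ) : ℤ :=
  t ^ 2 - ((A.ncard : ℤ) - 1) * t + (∑ᶠ q ∈ points A, mu A q) - A.ncard + 1

/-- `A` is divisionally free: `χ₀(A; |A^H| - 1) = 0` for some `H ∈ A`. -/
def IsDivisionallyFree (A : Set (Submodule K (Fin 3 → K))) : Prop :=
  ∃ H ∈ A, chi0 A ((restriction A H).ncard - 1) = 0

/-! ### Logarithmic vector fields -/

/-- The linear form `a₀ x₀ + a₁ x₁ + a₂ x₂` in `S = K[x₀, x₁, x₂]`. -/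
def linForm (a : Fin 3 → K) : MvPolynomial (Fin 3) K :=
  ∑ i, C (a i) * X i

/-- `H` is the zero set of the linear form with coefficients `a`. For a plane `H` such an `a` exists,
is nonzero, and is unique up to a nonzero scalar, and `linForm a` is the defining form `α_H`. -/
def Defines (a : Fin 3 → K) (H : Submodule K (Fin 3 → K)) : Prop :=
  ∀ v : Fin 3 → K, v ∈ H ↔ ∑ i, a i * v i = 0

/-- The module `D(A)` of the derivations `θ` of `S` with `θ(α_H) ∈ S α_H` for all `H ∈ A`. -/
def logDer (A : Set (Submodule K (Fin 3 → K))) :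
    Submodule (MvPolynomial (Fin 3) K)
      (Derivation K (MvPolynomial (Fin 3) K) (MvPolynomial (Fin 3) K)) where
  carrier := {θ | ∀ H ∈ A, ∀ a, Defines a H → linForm a ∣ θ (linForm a)}
  add_mem' h₁ h₂ H hH a ha := by
    rw [Derivation.add_apply]
    exact dvd_add (h₁ H hH a ha) (h₂ H hH a ha)
  zero_mem' H _ a _ := by simp
  smul_mem' f θ h H hH a ha := by
    rw [Derivation.smul_apply, smul_eq_mul]
    exact Dvd.dvd.mul_left (h H hH a ha) f

/-- The submodule `D_H(A)` of the `θ ∈ D(A)` with `θ(α_H) = 0`. -/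
def logDerAt (A : Set (Submodule K (Fin 3 → K))) (H : Submodule K (Fin 3 → K)) :
    Submodule (MvPolynomial (Fin 3) K)
      (Derivation K (MvPolynomial (Fin 3) K) (MvPolynomial (Fin 3) K)) where
  carrier := {θ | θ ∈ logDer A ∧ ∀ a, Defines a H → θ (linForm a) = 0}
  add_mem' h₁ h₂ := ⟨add_mem h₁.1 h₂.1, fun a ha => by
    rw [Derivation.add_apply, h₁.2 a ha, h₂.2 a ha, add_zero]⟩
  zero_mem' := ⟨zero_mem _, fun a _ => by simp⟩
  smul_mem' f θ h := ⟨Submodule.smul_mem _ f h.1, fun a ha => by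
    rw [Derivation.smul_apply, h.2 a ha, smul_zero]⟩

/-- `θ` is homogeneous of degree `d`: the polynomials `θ(x₀), θ(x₁), θ(x₂)` are in `S_d`. -/
def IsHomogeneousDer (θ : Derivation K (MvPolynomial (Fin 3) K) (MvPolynomial (Fin 3) K))
    (d : ℕ) : Prop :=
  ∀ i, (θ (X i)).IsHomogeneous d

/-- The Euler derivation `x₀ ∂₀ + x₁ ∂₁ + x₂ ∂₂`. -/
def euler (K : Type*) [Field K] :
    Derivation K (MvPolynomial (Fin 3) K) (MvPolynomial (Fin 3) K) :=
  mkDerivation K fun i => X i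

/-- `A` is free with exponents `(1, d₂, d₃)`: the Euler derivation and homogeneous derivations of
degrees `d₂` and `d₃` form a basis of the `S`-module `D(A)`. -/
def IsFreeWith (A : Set (Submodule K (Fin 3 → K))) (d₂ d₃ : ℕ) : Prop :=
  ∃ θ₂ ∈ logDer A, ∃ θ₃ ∈ logDer A, IsHomogeneousDer θ₂ d₂ ∧ IsHomogeneousDer θ₃ d₃ ∧
    LinearIndependent (MvPolynomial (Fin 3) K) ![euler K, θ₂, θ₃] ∧
    Submodule.span (MvPolynomial (Fin 3) K) {euler K, θ₂, θ₃} = logDer A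

/-- `A` is free. -/
def IsFree (A : Set (Submodule K (Fin 3 → K))) : Prop :=
  ∃ d₂ d₃, IsFreeWith A d₂ d₃

/-- The minimal degree relation: the least degree of a nonzero homogeneous element of `D_H(A)`. This
degree is the same for all `H ∈ A`, since `D(A)` is the direct sum of `S θ_E` and `D_H(A)`, so the
minimum may be taken over all `H ∈ A`. -/
def mdr (A : Set (Submodule K (Fin 3 → K))) : ℕ :=
  sInf {d | ∃ H ∈ A, ∃ θ ∈ logDerAt A H, θ ≠ 0 ∧ IsHomogeneousDer θ d}

end LineArrangement

end

noncomputable section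

namespace LineArrangement

open MvPolynomial

variable {K : Type u} [Field K]

/-! Suppose that no point of `A` is double. Fix `H ∈ A` and let `N = |A| - 1`, `r = |A^H|`. Each of
the `r` points of `H` lies on at least two further lines, so `2 r ≤ N`.

The core is that a nonzero homogeneous element of `D_H(A)` has degree at least `r`. Restricted to
`H` it is a binary field `f u + g w`, and at a point with parameter `q` the polynomial `g - q f`
vanishes to the order `m^H(q) ≥ 2`. Then `g - t f` and `g' - t f'` vanish at all `r` parameters; in
degree below `r` and characteristic zero this forces `f = g = 0` (`eq_zero_of_sq_dvd`). So the field
is divisible by `α_H`, the quotient is again tangent to the other lines, and descent on the degree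
gives zero (`Frame.eq_zero_of_lt`). Hence `mdr(A) ≥ |A^H|` for every `H`, which is condition 5. The
existence of an element of `D_H(A)` in a given degree is independent of `H`, by subtracting
multiples of the Euler field.

The second tool bounds the conditions imposed by an added line. If `θ` is tangent to `A \ {H}`, then
`θ(α_H)` restricted to `H` is divisible by a polynomial of degree `N - r` (`Chart.prod_dvd`). So in
degree `k` tangency to `H` costs at most `k + 1 - (N - r)` conditions, and none if `k < N - r`.

Supersolvable case: if `m` lines pass through the modular point, counting conditions gives a field
of degree `m - 1`, while a line avoiding that point has at least `m` points. For a nearly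
supersolvable arrangement this field of the larger arrangement is used on a suitable line. Free
deletion: for exponents `d₂ ≤ d₃` of `A \ {H}` one has `d₂ + d₃ < N`. Either both are below `N - r`
and all of `D(A \ {H})` is tangent to `H`, which is absurd, or `d₂ < r` and the field of degree `d₂`
lies in `D(A)`, against the core. Divisional freeness: `dim D_H(A)_N` is bounded below through `∑ μ`
by counting conditions, and above by restricting to `H`, where the dimensions grow at most as for
exponents `r, N - r`. A root `r - 1` of `χ₀` makes these bounds incompatible. Inductive freeness
implies divisional freeness. Condition 4: a line avoiding `p` meets the lines through `p` in
distinct points, too many for `2 r ≤ N`. -/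

/-! ### Linear forms -/

/-- The `S`-linear combination `∑ aᵢ Pᵢ`: the value at `linForm a` of the derivation `∑ Pᵢ ∂ᵢ`. -/
def dot (a : Fin 3 → K) (P : Fin 3 → MvPolynomial (Fin 3) K) : MvPolynomial (Fin 3) K :=
  ∑ i, C (a i) * P i

lemma dot_X (a : Fin 3 → K) : dot a X = linForm a := rfl

lemma dot_add_left (a b : Fin 3 → K) (P : Fin 3 → MvPolynomial (Fin 3) K) :
    dot (a + b) P = dot a P + dot b P := by
  simp [dot, add_mul, Finset.sum_add_distrib]

lemma dot_smul_left (c : K) (a : Fin 3 → K) (P : Fin 3 → MvPolynomial (Fin 3) K) :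
    dot (c • a) P = C c * dot a P := by
  simp [dot, Finset.mul_sum, mul_assoc]

lemma dot_add_right (a : Fin 3 → K) (P Q : Fin 3 → MvPolynomial (Fin 3) K) :
    dot a (P + Q) = dot a P + dot a Q := by
  simp [dot, mul_add, Finset.sum_add_distrib]

lemma dot_smul_right (a : Fin 3 → K) (f : MvPolynomial (Fin 3) K)
    (P : Fin 3 → MvPolynomial (Fin 3) K) : dot a (f • P) = f * dot a P := by
  simp only [dot, Finset.mul_sum, Pi.smul_apply, smul_eq_mul]
  exact Finset.sum_congr rfl fun i _ => by ring

lemma dot_C_smul_right (a : Fin 3 → K) (c : K)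
    (P : Fin 3 → MvPolynomial (Fin 3) K) : dot a (c • P) = c • dot a P := by
  simp [dot, Finset.smul_sum]

lemma dot_zero_right (a : Fin 3 → K) : dot a 0 = 0 := by simp [dot]

lemma dot_homogeneous {a : Fin 3 → K} {P : Fin 3 → MvPolynomial (Fin 3) K} {d : ℕ}
    (hP : ∀ i, (P i).IsHomogeneous d) : (dot a P).IsHomogeneous d :=
  IsHomogeneous.sum _ _ _ fun i _ => (hP i).C_mul _

lemma linForm_homogeneous (a : Fin 3 → K) : (linForm a).IsHomogeneous 1 :=
  dot_homogeneous fun i => isHomogeneous_X K i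

lemma coeff_linForm (a : Fin 3 → K) (i : Fin 3) :
    (linForm a).coeff (Finsupp.single i 1) = a i := by
  classical
  simp [linForm, coeff_sum, coeff_C_mul, coeff_X, Finsupp.single_left_inj]

lemma linForm_injective : Function.Injective (linForm : (Fin 3 → K) → _) := fun a b h => by
  funext i
  rw [← coeff_linForm a i, h, coeff_linForm]

lemma linForm_ne_zero {a : Fin 3 → K} (ha : a ≠ 0) : linForm a ≠ 0 := fun h => ha <| by
  funext i
  rw [← coeff_linForm a i, h, coeff_zero, Pi.zero_apply]

lemma linForm_irreducible {a : Fin 3 → K} (ha : a ≠ 0) : Irreducible (linForm a) := by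
  refine irreducible_of_totalDegree_eq_one
    ((linForm_homogeneous a).totalDegree (linForm_ne_zero ha)) fun x hx => ?_
  obtain ⟨i, hi⟩ := Function.ne_iff.1 ha
  have := hx (Finsupp.single i 1)
  rw [coeff_linForm] at this
  exact isUnit_of_dvd_unit this (isUnit_iff_ne_zero.2 hi)

lemma linForm_prime {a : Fin 3 → K} (ha : a ≠ 0) : Prime (linForm a) :=
  (linForm_irreducible ha).prime

lemma linForm_smul (c : K) (a : Fin 3 → K) : linForm (c • a) = C c * linForm a :=
  dot_smul_left c a X

/-- A linear form dividing another one is proportional to it. -/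
lemma exists_smul_of_linForm_dvd {a b : Fin 3 → K} (h : linForm a ∣ linForm b) :
    ∃ c : K, b = c • a := by
  by_cases hb : b = 0
  · exact ⟨0, by simp [hb]⟩
  have hb' := linForm_ne_zero hb
  obtain ⟨g, hg⟩ := h
  have hne : linForm a ≠ 0 ∧ g ≠ 0 := by
    rw [hg] at hb'; exact ⟨left_ne_zero_of_mul hb', right_ne_zero_of_mul hb'⟩
  have h0 : g.totalDegree = 0 := by
    have := congrArg totalDegree hg
    rw [totalDegree_mul_of_isDomain hne.1 hne.2, (linForm_homogeneous a).totalDegree hne.1,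
      (linForm_homogeneous b).totalDegree hb'] at this
    omega
  obtain ⟨c, rfl⟩ : ∃ c, g = C c := ⟨_, totalDegree_eq_zero_iff_eq_C.1 h0⟩
  refine ⟨c, linForm_injective ?_⟩
  rw [hg, linForm_smul, mul_comm]

lemma linForm_isRelPrime {a b : Fin 3 → K} (ha : a ≠ 0) (h : ∀ c : K, b ≠ c • a) :
    IsRelPrime (linForm a) (linForm b) :=
  ((linForm_irreducible ha).isRelPrime_iff_not_dvd).2 fun hd => by
    obtain ⟨c, hc⟩ := exists_smul_of_linForm_dvd hd
    exact h c hc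

/-- The quotient of a form of degree `d + 1` by a linear form is a form of degree `d`. -/
lemma exists_homogeneous_factor {a : Fin 3 → K} {f : MvPolynomial (Fin 3) K} {d : ℕ}
    (hf : f.IsHomogeneous (d + 1)) (h : linForm a ∣ f) :
    ∃ g : MvPolynomial (Fin 3) K, g.IsHomogeneous d ∧ f = linForm a * g := by
  obtain ⟨g, rfl⟩ := h
  -- The cofactor is replaced by its component of degree `d`; comparing components of degree `d + 1`
  -- shows that nothing is lost.
  refine ⟨homogeneousComponent d g, homogeneousComponent_isHomogeneous _ _, ?_⟩
  let := gradedAlgebra (σ := Fin 3) (R := K)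
  have h1 := DirectSum.coe_decompose_mul_of_left_mem_of_le
    (homogeneousSubmodule (Fin 3) K) (b := g) (n := d + 1) (i := 1)
    (linForm_homogeneous a) (by omega)
  have h2 : ∀ (p : MvPolynomial (Fin 3) K) (n : ℕ),
      (DirectSum.decompose (homogeneousSubmodule (Fin 3) K) p n : MvPolynomial (Fin 3) K)
        = homogeneousComponent n p := fun p n => decomposition.decompose'_apply p n
  rw [h2, h2, homogeneousComponent_eq_self hf] at h1
  simpa using h1

lemma eq_zero_of_linForm_dvd_of_homogeneous_zero {a : Fin 3 → K} (ha : a ≠ 0)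
    {f : MvPolynomial (Fin 3) K} (hf : f.IsHomogeneous 0) (h : linForm a ∣ f) : f = 0 := by
  obtain ⟨c, rfl⟩ : ∃ c, f = C c :=
    ⟨_, totalDegree_eq_zero_iff_eq_C.1 ((totalDegree_zero_iff_isHomogeneous _).2 hf)⟩
  by_contra hc
  have hc' : c ≠ 0 := fun h => hc (by simp [h])
  exact (linForm_irreducible ha).not_isUnit
    (isUnit_of_dvd_unit h ((isUnit_iff_ne_zero.2 hc').map C))

lemma homogeneousComponent_mul_right {f g : MvPolynomial (Fin 3) K} {d k : ℕ}
    (hg : g.IsHomogeneous d) (h : d ≤ k) :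
    homogeneousComponent k (f * g) = homogeneousComponent (k - d) f * g := by
  let := gradedAlgebra (σ := Fin 3) (R := K)
  have h1 := DirectSum.coe_decompose_mul_of_right_mem_of_le
    (homogeneousSubmodule (Fin 3) K) (a := f) (n := k) (i := d) hg h
  have h2 : ∀ (p : MvPolynomial (Fin 3) K) (n : ℕ),
      (DirectSum.decompose (homogeneousSubmodule (Fin 3) K) p n : MvPolynomial (Fin 3) K)
        = homogeneousComponent n p := fun p n => decomposition.decompose'_apply p n
  rwa [h2, h2] at h1

instance finite_homogeneousSubmodule (k : ℕ) :
    Module.Finite K (homogeneousSubmodule (Fin 3) K k) :=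
  Module.Finite.iff_fg.2 (homogeneousSubmodule_fg (Fin 3) K k)

/-- `dim S_k = (k + 1)(k + 2) / 2`. -/
lemma two_mul_finrank_homogeneousSubmodule (k : ℕ) :
    2 * Module.finrank K (homogeneousSubmodule (Fin 3) K k) = (k + 1) * (k + 2) := by
  have h1 : Module.finrank K (homogeneousSubmodule (Fin 3) K k) = (3 + k - 1).choose k := by
    rw [homogeneousSubmodule_eq_finsupp_supported]
    have e := AddMonoidAlgebra.supportedEquivFinsupp (R := K) (S := K)
      {d : Fin 3 →₀ ℕ | d.degree = k}
    have hs : {d : Fin 3 →₀ ℕ | d.degree = k} =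
        ((Finset.univ : Finset (Fin 3)).finsuppAntidiag k : Set _) := by
      ext d
      simp [Finset.mem_finsuppAntidiag, Finsupp.degree_eq_sum]
    rw [e.finrank_eq, hs, Module.finrank_finsupp_self]
    simp [Finset.card_finsuppAntidiag_nat_eq_choose]
  rw [h1, show 3 + k - 1 = k + 2 by omega, Nat.choose_symm_add, Nat.choose_two_right]
  have := Nat.div_mul_cancel (Nat.even_mul_pred_self (k + 2)).two_dvd
  rw [mul_comm, this]
  simp [mul_comm]

/-! ### Restriction to a line -/

open Polynomial in
/-- Restriction of polynomials to the parametrized affine line `u + t w`. -/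
def ev (u w : Fin 3 → K) : MvPolynomial (Fin 3) K →ₐ[K] K[X] :=
  aeval fun i => Polynomial.C (u i) + Polynomial.C (w i) * Polynomial.X

lemma ev_X (u w : Fin 3 → K) (i : Fin 3) :
    ev u w (X i) = Polynomial.C (u i) + Polynomial.C (w i) * Polynomial.X := by
  simp [ev]

lemma ev_C (u w : Fin 3 → K) (c : K) : ev u w (C c) = Polynomial.C c := by
  simp [ev, Polynomial.algebraMap_eq]

lemma ev_dot (u w b : Fin 3 → K) (P : Fin 3 → MvPolynomial (Fin 3) K) :
    ev u w (dot b P) = ∑ i, Polynomial.C (b i) * ev u w (P i) := by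
  simp only [dot, map_sum, map_mul, ev_C]

lemma ev_linForm (u w b : Fin 3 → K) :
    ev u w (linForm b) = Polynomial.C (b ⬝ᵥ u) + Polynomial.C (b ⬝ᵥ w) * Polynomial.X := by
  rw [← dot_X, ev_dot]
  simp only [ev_X, dotProduct, mul_add, Finset.sum_add_distrib, map_sum, map_mul, Finset.sum_mul,
    mul_assoc]

lemma natDegree_ev_le (u w : Fin 3 → K) {f : MvPolynomial (Fin 3) K} {d : ℕ}
    (hf : f.IsHomogeneous d) : (ev u w f).natDegree ≤ d := by
  have := aeval_natDegree_le (n := 1) f hf.totalDegree_le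
    (fun i => Polynomial.C (u i) + Polynomial.C (w i) * Polynomial.X) fun i => by compute_degree
  rwa [mul_one] at this

lemma eval_ev (u w : Fin 3 → K) (f : MvPolynomial (Fin 3) K) (c : K) :
    (ev u w f).eval c = eval (u + c • w) f := by
  have : (Polynomial.evalRingHom c).comp (ev u w : _ →+* Polynomial K) = eval (u + c • w) := by
    refine MvPolynomial.ringHom_ext (fun r => ?_) fun i => ?_
    · simp
    · simp only [RingHom.comp_apply, RingHom.coe_coe, ev_X, Polynomial.coe_evalRingHom, eval_X]
      simp [mul_comm (w i)]
  exact congrArg (fun φ => φ f) this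

lemma eval_smul_of_homogeneous {f : MvPolynomial (Fin 3) K} {d : ℕ} (hf : f.IsHomogeneous d)
    (c : K) (v : Fin 3 → K) : eval (c • v) f = c ^ d * eval v f := by
  rw [eval_eq', eval_eq', Finset.mul_sum]
  refine Finset.sum_congr rfl fun m hm => ?_
  have h : ∑ i, m i = d := by
    rw [← Finsupp.degree_eq_sum, Finsupp.degree_eq_weight_one]
    exact hf (mem_support_iff.1 hm)
  simp only [Pi.smul_apply, smul_eq_mul, mul_pow, Finset.prod_mul_distrib]
  rw [Finset.prod_pow_eq_pow_sum, h]
  ring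

/-- A parametrization of the plane `a = 0` by a basis `u, w`, with a coordinate system of the
ambient space adapted to it. -/
structure Frame (a u w : Fin 3 → K) where
  e : Fin 3 → K
  s : Fin 3 → K
  t : Fin 3 → K
  au : a ⬝ᵥ u = 0
  aw : a ⬝ᵥ w = 0
  ae : a ⬝ᵥ e = 1
  su : s ⬝ᵥ u = 1
  decomp : ∀ i j, (if i = j then 1 else 0) = a i * e j + s i * u j + t i * w j

namespace Frame

variable {a u w : Fin 3 → K}

lemma a_ne_zero (F : Frame a u w) : a ≠ 0 := by
  rintro rfl
  simpa using F.ae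

lemma dual_decomp (F : Frame a u w) (b : Fin 3 → K) :
    b = (b ⬝ᵥ F.e) • a + (b ⬝ᵥ u) • F.s + (b ⬝ᵥ w) • F.t := by
  funext i
  have h : b i = ∑ j, (if i = j then 1 else 0) * b j := by simp
  rw [h]
  simp only [F.decomp, dotProduct, Pi.add_apply, Pi.smul_apply, smul_eq_mul, Finset.sum_mul,
    ← Finset.sum_add_distrib]
  exact Finset.sum_congr rfl fun j _ => by ring

lemma vec_decomp (F : Frame a u w) (P : Fin 3 → MvPolynomial (Fin 3) K) (j : Fin 3) :
    P j = C (F.e j) * dot a P + C (u j) * dot F.s P + C (w j) * dot F.t P := by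
  have h : P j = ∑ i, C (if i = j then 1 else 0) * P i := by simp
  rw [h]
  simp only [F.decomp, dot, Finset.mul_sum, ← Finset.sum_add_distrib, map_add, map_mul]
  exact Finset.sum_congr rfl fun j _ => by ring

lemma ev_linForm_self (F : Frame a u w) : ev u w (linForm a) = 0 := by
  rw [ev_linForm, F.au, F.aw]; simp

lemma ev_eq_zero_of_dvd (F : Frame a u w)
    {f : MvPolynomial (Fin 3) K} (h : linForm a ∣ f) : ev u w f = 0 := by
  obtain ⟨g, rfl⟩ := h
  rw [map_mul, F.ev_linForm_self, zero_mul]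

/-- `f` agrees modulo `linForm a` with its pullback along the projection onto the plane. -/
lemma dvd_sub_aeval (F : Frame a u w) (f : MvPolynomial (Fin 3) K) :
    linForm a ∣ f - aeval (fun j => C (u j) * linForm F.s + C (w j) * linForm F.t) f := by
  rw [← Ideal.mem_span_singleton, ← Ideal.Quotient.mk_eq_mk_iff_sub_mem]
  have : (Ideal.Quotient.mkₐ K (Ideal.span {linForm a})) =
      (Ideal.Quotient.mkₐ K (Ideal.span {linForm a})).comp
        (aeval fun j => C (u j) * linForm F.s + C (w j) * linForm F.t) := by
    refine MvPolynomial.algHom_ext fun j => ?_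
    simp only [AlgHom.comp_apply, aeval_X, Ideal.Quotient.mkₐ_eq_mk]
    rw [Ideal.Quotient.mk_eq_mk_iff_sub_mem, Ideal.mem_span_singleton]
    refine ⟨C (F.e j), ?_⟩
    have := F.vec_decomp X j
    simp only [dot_X] at this
    linear_combination this
  exact congrArg (fun φ => φ f) this

/-- Restricting to the affine line `u + t w` is dehomogenization on the plane `a = 0`, which loses
nothing for homogeneous polynomials. -/
lemma ev_eq_zero_iff (F : Frame a u w) [Infinite K] {f : MvPolynomial (Fin 3) K} {d : ℕ}
    (hf : f.IsHomogeneous d) : ev u w f = 0 ↔ linForm a ∣ f := by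
  refine ⟨fun h => ?_, F.ev_eq_zero_of_dvd⟩
  set G := aeval (fun j => C (u j) * linForm F.s + C (w j) * linForm F.t) f with hG
  suffices G = 0 by
    have h1 := F.dvd_sub_aeval f
    rwa [← hG, this, sub_zero] at h1
  have hs : F.s ≠ 0 := fun hs => by
    have := F.su
    rw [hs, zero_dotProduct] at this
    exact zero_ne_one this
  -- Where `s ≠ 0`, the projection to the plane is a scalar multiple of a point `u + t w`, so
  -- homogeneity applies. The factor `s` disposes of the points at infinity.
  have hmul : linForm F.s * G = 0 := by
    refine MvPolynomial.funext fun v => ?_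
    rw [map_mul, map_zero]
    by_cases h0 : eval v (linForm F.s) = 0
    · rw [h0, zero_mul]
    set c := eval v (linForm F.s)
    set c' := eval v (linForm F.t)
    have h1 : eval v G = eval (fun j => u j * c + w j * c') f := by
      have : ((eval v : MvPolynomial (Fin 3) K →+* K).comp
          (aeval fun j => C (u j) * linForm F.s + C (w j) * linForm F.t :
            MvPolynomial (Fin 3) K →ₐ[K] MvPolynomial (Fin 3) K).toRingHom) =
          eval (fun j => u j * c + w j * c') := by
        refine MvPolynomial.ringHom_ext (fun r => ?_) fun i => ?_
        · simp
        · simp [c, c']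
      exact congrArg (fun φ => φ f) this
    have h2 : (fun j => u j * c + w j * c') = c • (u + (c' / c) • w) := by
      funext j; simp; field_simp
    have h3 : eval (c • (u + (c' / c) • w)) f = c ^ d * eval (u + (c' / c) • w) f :=
      eval_smul_of_homogeneous hf _ _
    rw [h1, h2, h3, ← eval_ev, h]; simp
  exact (mul_eq_zero.1 hmul).resolve_left (linForm_ne_zero hs)

/-- If all `linForm (b + c • a)`, `c ∈ T`, divide `G`, then the restriction of `G` has a zero of
order `#T` at the common point of these lines. -/
lemma pow_dvd_ev (F : Frame a u w)
    {b : Fin 3 → K} (hb : b ⬝ᵥ w = 1) {T : Finset K} {G : MvPolynomial (Fin 3) K}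
    (hG : ∀ c ∈ T, linForm (b + c • a) ∣ G) :
    (Polynomial.X - Polynomial.C (-(b ⬝ᵥ u))) ^ T.card ∣ ev u w G := by
  have hw : ∀ c : K, (b + c • a) ⬝ᵥ w = 1 := fun c => by simp [add_dotProduct, hb, F.aw]
  have hu : ∀ c : K, (b + c • a) ⬝ᵥ u = b ⬝ᵥ u := fun c => by simp [add_dotProduct, F.au]
  have h1 : ∏ c ∈ T, linForm (b + c • a) ∣ G := by
    refine Finset.prod_dvd_of_isRelPrime (fun c _ c' _ hcc => ?_) hG
    refine linForm_isRelPrime (fun h => ?_) fun k hk => hcc ?_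
    · have := hw c; rw [h] at this; simp at this
    · have h2 := congrArg (· ⬝ᵥ w) hk
      simp only [smul_dotProduct, hw, smul_eq_mul, mul_one] at h2
      rw [← h2, one_smul, add_right_inj] at hk
      exact (smul_left_injective K F.a_ne_zero hk).symm
  have h2 := map_dvd (ev u w) h1
  rw [map_prod] at h2
  convert h2 using 1
  rw [← Finset.prod_const]
  refine Finset.prod_congr rfl fun c _ => ?_
  rw [ev_linForm, hu, hw]
  simp
  ring

end Frame

/-! ### Logarithmic vector fields along a line

The lines other than the plane `a = 0` are given by a finite set `ℬ` of vectors `b`, normalized by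
`b ⬝ᵥ w = 1`; such a line meets the plane `a = 0` in the point with parameter `-(b ⬝ᵥ u)`. -/

/-- The parameter of the intersection point with the line `u + t w`. -/
def param (u b : Fin 3 → K) : K := -(b ⬝ᵥ u)

open Classical in
/-- The parameters of all intersection points. -/
def params (u : Fin 3 → K) (ℬ : Finset (Fin 3 → K)) : Finset K := ℬ.image (param u)

open Classical in
/-- The members of `ℬ` passing through the point with parameter `q`. -/
def fib (u : Fin 3 → K) (ℬ : Finset (Fin 3 → K)) (q : K) : Finset (Fin 3 → K) :=
  ℬ.filter fun b => param u b = q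

lemma sum_card_fib (u : Fin 3 → K) (ℬ : Finset (Fin 3 → K)) :
    ∑ q ∈ params u ℬ, (fib u ℬ q).card = ℬ.card := by
  classical
  exact (Finset.card_eq_sum_card_image (param u) ℬ).symm

lemma fib_card_pos {u : Fin 3 → K} {ℬ : Finset (Fin 3 → K)} {q : K} (hq : q ∈ params u ℬ) :
    1 ≤ (fib u ℬ q).card := by
  classical
  obtain ⟨b, hb, rfl⟩ := Finset.mem_image.1 hq
  exact Finset.card_pos.2 ⟨b, Finset.mem_filter.2 ⟨hb, rfl⟩⟩

/-- The vector field `P` is tangent to all members of `ℬ`. -/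
def LogOn (ℬ : Finset (Fin 3 → K)) (P : Fin 3 → MvPolynomial (Fin 3) K) : Prop :=
  ∀ b ∈ ℬ, linForm b ∣ dot b P

/-! ### Binary fields tangent of order two at many points -/

/-- In characteristic zero, a binary vector field of degree less than the number of points cannot be
tangent of order two at each of the points. -/
lemma eq_zero_of_sq_dvd [CharZero K] {T : Finset K} {f g : Polynomial K} {d : ℕ}
    (hf : f.natDegree ≤ d) (hg : g.natDegree ≤ d) (hd : d < T.card) (hT : 2 ≤ T.card)
    (h : ∀ q ∈ T, (Polynomial.X - Polynomial.C q) ^ 2 ∣ g - Polynomial.C q * f) :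
    f = 0 ∧ g = 0 := by
  have h1 : ∀ q ∈ T, g.eval q = q * f.eval q := fun q hq => by
    obtain ⟨r, hr⟩ := h q hq
    have := congrArg (Polynomial.eval q) hr
    simp at this
    linear_combination this
  have h2 : ∀ q ∈ T, (Polynomial.derivative g).eval q = q * (Polynomial.derivative f).eval q :=
    fun q hq => by
    obtain ⟨r, hr⟩ := h q hq
    have := congrArg (fun p => Polynomial.eval q (Polynomial.derivative p)) hr
    simp [Polynomial.derivative_mul, Polynomial.derivative_pow] at this
    linear_combination this
  have hdf : (Polynomial.X * Polynomial.derivative f).natDegree ≤ d := by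
    by_cases h0 : Polynomial.derivative f = 0
    · simp [h0]
    rw [Polynomial.natDegree_X_mul h0]
    have : f.natDegree ≠ 0 := fun h00 => h0 (Polynomial.derivative_of_natDegree_zero h00)
    have := Polynomial.natDegree_derivative_lt this
    omega
  -- In `g - q f` the number `q` is a constant, so the derivative at `q` contains no term `f(q)`.
  -- That term appears only when `g = X f` is differentiated, and this contrast yields `f = 0` at
  -- the end.
  have h3 : Polynomial.derivative g - Polynomial.X * Polynomial.derivative f = 0 := by
    refine Polynomial.eq_zero_of_natDegree_lt_card_of_eval_eq_zero' _ T (fun q hq => ?_)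
      (lt_of_le_of_lt (Polynomial.natDegree_sub_le_of_le ((Polynomial.natDegree_derivative_le g).trans
        ((Nat.sub_le _ _).trans hg)) hdf) (by simpa using hd))
    simp [h2 q hq]
  have hX : ∀ k, f.natDegree ≤ k → (Polynomial.X * f).natDegree ≤ k + 1 := fun k hk =>
    Polynomial.natDegree_mul_le.trans (by rw [Polynomial.natDegree_X]; omega)
  have hdeg : (g - Polynomial.X * f).natDegree < T.card := by
    rcases Nat.eq_zero_or_pos d with rfl | hpos
    -- For constant fields `X f` may have degree one; here two points are needed.
    · have := Polynomial.natDegree_sub_le_of_le (hg.trans (Nat.zero_le 1)) (hX 0 hf)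
      omega
    · obtain ⟨k, rfl⟩ : ∃ k, d = k + 1 := ⟨d - 1, by omega⟩
      -- A priori `X f` has degree `d + 1`, one too many. The top coefficient of `g' = X f'` kills
      -- the coefficient of `f` in degree `d`, as `d` is nonzero in `K`.
      have hc := congrArg (fun p => Polynomial.coeff p (k + 1)) h3
      simp only [Polynomial.coeff_sub, Polynomial.coeff_derivative, Polynomial.coeff_X_mul,
        Polynomial.coeff_zero,
        Polynomial.coeff_eq_zero_of_natDegree_lt (show g.natDegree < k + 1 + 1 by omega),
        zero_mul, zero_sub, neg_eq_zero, mul_eq_zero] at hc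
      have hc : f.coeff (k + 1) = 0 :=
        hc.resolve_right (by exact_mod_cast Nat.succ_ne_zero k)
      have hfk : f.natDegree ≤ k := by
        rw [Polynomial.natDegree_le_iff_coeff_eq_zero]
        intro N hN
        rcases Nat.eq_or_lt_of_le hN with h | h
        · rw [← h]; exact hc
        · exact Polynomial.coeff_eq_zero_of_natDegree_lt (by omega)
      have := Polynomial.natDegree_sub_le_of_le hg (hX k hfk)
      omega
  have h4 : g - Polynomial.X * f = 0 :=
    Polynomial.eq_zero_of_natDegree_lt_card_of_eval_eq_zero' _ T (fun q hq => by simp [h1 q hq])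
      hdeg
  have h5 : g = Polynomial.X * f := sub_eq_zero.1 h4
  have h6 : f = 0 := by
    rw [h5, Polynomial.derivative_mul, Polynomial.derivative_X] at h3
    linear_combination h3
  exact ⟨h6, by rw [h5, h6, mul_zero]⟩

lemma isCoprime_pow_X_sub_C (n : K → ℕ) (T : Set K) :
    T.Pairwise (Function.onFun IsCoprime
      fun q => (Polynomial.X - Polynomial.C q) ^ n q) := fun _ _ _ _ hq =>
  IsCoprime.pow (Polynomial.pairwise_coprime_X_sub_C Function.injective_id hq)

lemma natDegree_prod_pow (n : K → ℕ) (T : Finset K) :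
    (∏ q ∈ T, (Polynomial.X - Polynomial.C q) ^ n q).natDegree = ∑ q ∈ T, n q := by
  rw [Polynomial.natDegree_prod_of_monic _ _ fun q _ => (Polynomial.monic_X_sub_C q).pow _]
  simp

lemma sum_card_fib_sub_one (u : Fin 3 → K) (ℬ : Finset (Fin 3 → K)) :
    ∑ q ∈ params u ℬ, ((fib u ℬ q).card - 1) = ℬ.card - (params u ℬ).card := by
  have h : ∑ q ∈ params u ℬ, ((fib u ℬ q).card - 1) + ∑ q ∈ params u ℬ, 1 = ℬ.card := by
    rw [← Finset.sum_add_distrib, ← sum_card_fib u ℬ]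
    exact Finset.sum_congr rfl fun q hq => Nat.sub_add_cancel (fib_card_pos hq)
  simp at h
  omega

namespace Frame

variable {a u w : Fin 3 → K} {ℬ : Finset (Fin 3 → K)}

lemma dot_eq (F : Frame a u w)
    {b : Fin 3 → K} (hb : b ⬝ᵥ w = 1) (P : Fin 3 → MvPolynomial (Fin 3) K) :
    dot b P = C (b ⬝ᵥ F.e) * dot a P - C (param u b) * dot F.s P + dot F.t P := by
  conv_lhs => rw [F.dual_decomp b, hb]
  simp only [dot_add_left, dot_smul_left, param]
  simp

/-- A member of `ℬ` through the same point as `b` is of the form `b + c a`. -/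
lemma eq_add_smul (F : Frame a u w) {b b' : Fin 3 → K} (hb : b ⬝ᵥ w = 1) (hb' : b' ⬝ᵥ w = 1)
    (h : param u b' = param u b) : b' = b + (b' ⬝ᵥ F.e - b ⬝ᵥ F.e) • a := by
  have h1 := F.dual_decomp b
  have h2 := F.dual_decomp b'
  have h3 : b' ⬝ᵥ u = b ⬝ᵥ u := neg_injective h
  rw [hb] at h1
  rw [hb', h3] at h2
  funext i
  have h4 := congrFun h1 i
  have h5 := congrFun h2 i
  simp only [Pi.add_apply, Pi.smul_apply, smul_eq_mul] at h4 h5 ⊢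
  linear_combination h5 - h4

open Classical in
/-- The multirestriction: a vector field tangent to `ℬ` and killing `a` restricts to the plane
`a = 0` as a vector field tangent of order `#(fib u ℬ q)` at each point `q`. -/
lemma pow_card_fib_dvd (F : Frame a u w)
    (hw : ∀ b ∈ ℬ, b ⬝ᵥ w = 1) {P : Fin 3 → MvPolynomial (Fin 3) K}
    (hP : LogOn ℬ P) (ha : dot a P = 0) (q : K) :
    (Polynomial.X - Polynomial.C q) ^ (fib u ℬ q).card ∣
      ev u w (dot F.t P) - Polynomial.C q * ev u w (dot F.s P) := by
  rcases (fib u ℬ q).eq_empty_or_nonempty with h0 | ⟨b, hbq⟩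
  · simp [h0]
  obtain ⟨hb, rfl⟩ := Finset.mem_filter.1 hbq
  have hbw := hw b hb
  -- Equations through one point differ by multiples of `a`, which `P` kills; so one polynomial is
  -- divisible by all of them.
  have key : ∀ b' ∈ fib u ℬ (param u b), dot b' P = dot b P := fun b' hb' => by
    obtain ⟨h1, h2⟩ := Finset.mem_filter.1 hb'
    rw [F.dot_eq (hw b' h1), F.dot_eq hbw, ha, h2]; ring
  have h1 := F.pow_dvd_ev hbw (G := dot b P)
    (T := (fib u ℬ (param u b)).image fun b' => b' ⬝ᵥ F.e - b ⬝ᵥ F.e) (fun c hc => by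
      obtain ⟨b', hb', rfl⟩ := Finset.mem_image.1 hc
      obtain ⟨h1, h2⟩ := Finset.mem_filter.1 hb'
      rw [← F.eq_add_smul hbw (hw b' h1) h2, ← key b' hb']
      exact hP b' h1)
  rw [Finset.card_image_of_injOn] at h1
  · rw [F.dot_eq hbw, ha] at h1
    have h3 : ev u w (C (b ⬝ᵥ F.e) * 0 - C (param u b) * dot F.s P + dot F.t P) =
        ev u w (dot F.t P) - Polynomial.C (param u b) * ev u w (dot F.s P) := by
      rw [mul_zero, zero_sub, map_add, map_neg, map_mul, ev_C]
      ring
    rwa [h3] at h1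
  · intro b₁ hb₁ b₂ hb₂ h12
    obtain ⟨h1, h2⟩ := Finset.mem_filter.1 hb₁
    obtain ⟨h3, h4⟩ := Finset.mem_filter.1 hb₂
    rw [F.eq_add_smul hbw (hw b₁ h1) h2, F.eq_add_smul hbw (hw b₂ h3) h4]
    simp only at h12
    rw [h12]

-- For `b` and `b' = b + c a` through the same point, write `dot b P = g b`. Modulo `b'` one has `b
-- ≡ -c a`, so `b'` divides `dot a P - g a`. This polynomial has the same restriction to `a = 0` as
-- `dot a P`, and every line of the fibre except `b` contributes a zero.
open Classical in
lemma pow_card_fib_sub_one_dvd (F : Frame a u w)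
    (hw : ∀ b ∈ ℬ, b ⬝ᵥ w = 1) {P : Fin 3 → MvPolynomial (Fin 3) K}
    (hP : LogOn ℬ P) (q : K) :
    (Polynomial.X - Polynomial.C q) ^ ((fib u ℬ q).card - 1) ∣ ev u w (dot a P) := by
  rcases (fib u ℬ q).eq_empty_or_nonempty with h0 | ⟨b, hbq⟩
  · simp [h0]
  obtain ⟨hb, rfl⟩ := Finset.mem_filter.1 hbq
  have hbw := hw b hb
  obtain ⟨g, hg⟩ := hP b hb
  have hev : ev u w (dot a P) = ev u w (dot a P - g * linForm a) := by
    rw [map_sub, map_mul, F.ev_linForm_self]; simp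
  have h1 := F.pow_dvd_ev hbw (G := dot a P - g * linForm a)
    (T := ((fib u ℬ (param u b)).erase b).image fun b' => b' ⬝ᵥ F.e - b ⬝ᵥ F.e) (fun c hc => by
      obtain ⟨b', hb', rfl⟩ := Finset.mem_image.1 hc
      obtain ⟨hne, hb'⟩ := Finset.mem_erase.1 hb'
      obtain ⟨h1, h2⟩ := Finset.mem_filter.1 hb'
      have h3 := F.eq_add_smul hbw (hw b' h1) h2
      set c := b' ⬝ᵥ F.e - b ⬝ᵥ F.e
      have hc : c ≠ 0 := fun hc => hne (by rw [h3, hc]; simp)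
      have h4 := hP b' h1
      rw [h3, dot_add_left, dot_smul_left, hg] at h4
      have h5 : linForm (b + c • a) ∣ C c * (dot a P - g * linForm a) := by
        have h6 : linForm (b + c • a) = linForm b + C c * linForm a := by
          rw [← dot_X, dot_add_left, dot_smul_left]; rfl
        have : C c * (dot a P - g * linForm a) =
            linForm b * g + C c * dot a P - linForm (b + c • a) * g := by
          rw [h6]; ring
        rw [this]
        exact dvd_sub h4 (dvd_mul_right _ _)
      exact (((isUnit_iff_ne_zero.2 hc).map C).dvd_mul_left).1 h5)
  rw [Finset.card_image_of_injOn, Finset.card_erase_of_mem hbq] at h1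
  · rw [hev]
    exact h1
  · intro b₁ hb₁ b₂ hb₂ h12
    obtain ⟨h1, h2⟩ := Finset.mem_filter.1 (Finset.mem_of_mem_erase hb₁)
    obtain ⟨h3, h4⟩ := Finset.mem_filter.1 (Finset.mem_of_mem_erase hb₂)
    rw [F.eq_add_smul hbw (hw b₁ h1) h2, F.eq_add_smul hbw (hw b₂ h3) h4]
    simp only at h12
    rw [h12]

lemma prod_dvd_ev (F : Frame a u w) (hw : ∀ b ∈ ℬ, b ⬝ᵥ w = 1) {P : Fin 3 → MvPolynomial (Fin 3) K}
    (hP : LogOn ℬ P) :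
    ∏ q ∈ params u ℬ, (Polynomial.X - Polynomial.C q) ^ ((fib u ℬ q).card - 1) ∣
      ev u w (dot a P) :=
  Finset.prod_dvd_of_coprime (isCoprime_pow_X_sub_C (fun q => (fib u ℬ q).card - 1) _)
    fun q _ => F.pow_card_fib_sub_one_dvd hw hP q

lemma not_linForm_dvd (F : Frame a u w)
    {b : Fin 3 → K} (hb : b ⬝ᵥ w = 1) : ¬ linForm b ∣ linForm a := fun h => by
  obtain ⟨c, hc⟩ := exists_smul_of_linForm_dvd h
  have := F.aw
  rw [hc, smul_dotProduct, hb] at this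
  have hc0 : c = 0 := by simpa using this
  exact F.a_ne_zero (by rw [hc, hc0, zero_smul])

/-- The restriction to `a = 0` is a binary field tangent of order two at more points than its
degree, hence zero. -/
lemma linForm_dvd_of_lt (F : Frame a u w) [CharZero K] (hw : ∀ b ∈ ℬ, b ⬝ᵥ w = 1)
    {P : Fin 3 → MvPolynomial (Fin 3) K} {d : ℕ} (hd : ∀ i, (P i).IsHomogeneous d)
    (hP : LogOn ℬ P) (ha : dot a P = 0) (h2 : ∀ q ∈ params u ℬ, 2 ≤ (fib u ℬ q).card)
    (hT : 2 ≤ (params u ℬ).card) (hlt : d < (params u ℬ).card) (j : Fin 3) :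
    linForm a ∣ P j := by
  obtain ⟨hs, ht⟩ := eq_zero_of_sq_dvd (natDegree_ev_le u w (dot_homogeneous (a := F.s) hd))
    (natDegree_ev_le u w (dot_homogeneous (a := F.t) hd)) hlt hT fun q hq =>
      (pow_dvd_pow _ (h2 q hq)).trans (F.pow_card_fib_dvd hw hP ha q)
  rw [← F.ev_eq_zero_iff (hd j), F.vec_decomp P j, ha]
  simp [hs, ht]

/-- If every point on the plane `a = 0` lies on at least two members of `ℬ`, then a nonzero
homogeneous vector field tangent to `ℬ` and killing `a` has degree at least the number of points. -/
lemma eq_zero_of_lt (F : Frame a u w) [CharZero K] (hw : ∀ b ∈ ℬ, b ⬝ᵥ w = 1)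
    (h2 : ∀ q ∈ params u ℬ, 2 ≤ (fib u ℬ q).card) (hT : 2 ≤ (params u ℬ).card) (d : ℕ)
    (hlt : d < (params u ℬ).card) (P : Fin 3 → MvPolynomial (Fin 3) K)
    (hd : ∀ i, (P i).IsHomogeneous d) (hP : LogOn ℬ P) (ha : dot a P = 0) : P = 0 := by
  induction d generalizing P with
  | zero =>
    funext j
    exact eq_zero_of_linForm_dvd_of_homogeneous_zero F.a_ne_zero (hd j)
      (F.linForm_dvd_of_lt hw hd hP ha h2 hT hlt j)
  | succ d ih =>
    choose P' hP' hPP' using fun j => exists_homogeneous_factor (hd j)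
      (F.linForm_dvd_of_lt hw hd hP ha h2 hT hlt j)
    have hP1 : P = linForm a • P' := funext hPP'
    -- Dividing by `a` preserves tangency to `b`, since the prime `b` does not divide `a`.
    have h0 : P' = 0 := by
      refine ih (by omega) P' hP' (fun b hb => ?_) ?_
      · have h1 := hP b hb
        rw [hP1, dot_smul_right] at h1
        have hb0 : b ≠ 0 := by
          rintro rfl
          simpa using hw 0 hb
        exact ((linForm_prime hb0).dvd_or_dvd h1).resolve_left (F.not_linForm_dvd (hw b hb))
      · rw [hP1, dot_smul_right] at ha
        exact (mul_eq_zero.1 ha).resolve_left (linForm_ne_zero F.a_ne_zero)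
    rw [hP1, h0, smul_zero]

end Frame

/-! ### Planes and their equations -/

lemma Defines.mem_iff {a : Fin 3 → K} {H : Submodule K (Fin 3 → K)} (h : Defines a H)
    (v : Fin 3 → K) : v ∈ H ↔ a ⬝ᵥ v = 0 := h v

lemma Defines.smul {a : Fin 3 → K} {H : Submodule K (Fin 3 → K)} (h : Defines a H) {c : K}
    (hc : c ≠ 0) : Defines (c • a) H := fun v => by
  rw [h.mem_iff v]
  change _ ↔ (c • a) ⬝ᵥ v = 0
  simp [smul_dotProduct, hc]

lemma exists_defines {H : Submodule K (Fin 3 → K)} (hH : Module.finrank K H = 2) :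
    ∃ a, a ≠ 0 ∧ Defines a H := by
  have hlt : H < ⊤ := by
    refine lt_top_iff_ne_top.2 fun h => ?_
    rw [h, finrank_top] at hH
    simp at hH
  obtain ⟨f, hf0, hf⟩ := Submodule.exists_le_ker_of_lt_top H hlt
  have hker : H = LinearMap.ker f := by
    refine Submodule.eq_of_le_of_finrank_eq hf ?_
    have h1 := f.finrank_range_add_finrank_ker
    have h2 : LinearMap.range f = ⊤ := LinearMap.range_eq_top.2 (LinearMap.surjective hf0)
    rw [h2, finrank_top, Module.finrank_self, Module.finrank_fin_fun] at h1
    omega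
  have hfa : ∀ v, f v = ∑ i, f (Pi.single i 1) * v i := fun v => by
    have h2 : v = ∑ i, v i • Pi.single i (1 : K) := by
      simp [← Pi.single_smul, Finset.univ_sum_single]
    conv_lhs => rw [h2]
    simp only [map_sum, map_smul, smul_eq_mul, mul_comm]
  refine ⟨fun i => f (Pi.single i 1), fun h => hf0 ?_, fun v => ?_⟩
  · ext i
    simpa using congrFun h i
  · rw [hker, LinearMap.mem_ker, hfa]

lemma finrank_inf_of_ne {H L : Submodule K (Fin 3 → K)} (hH : Module.finrank K H = 2)
    (hL : Module.finrank K L = 2) (h : H ≠ L) : Module.finrank K (H ⊓ L : Submodule K _) = 1 := by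
  have h1 := Submodule.finrank_sup_add_finrank_inf_eq H L
  have h2 : Module.finrank K (H ⊔ L : Submodule K _) ≤ 3 :=
    (Submodule.finrank_le _).trans (by simp)
  have h3 : Module.finrank K H < Module.finrank K (H ⊔ L : Submodule K _) := by
    refine Submodule.finrank_lt_finrank_of_lt (lt_of_le_of_ne le_sup_left fun h' => h ?_)
    exact (Submodule.eq_of_le_of_finrank_eq (h' ▸ le_sup_right) (by rw [hH, hL])).symm
  omega

lemma eq_of_le_of_plane {H L : Submodule K (Fin 3 → K)} (hH : Module.finrank K H = 2)
    (hL : Module.finrank K L = 2) (h : H ≤ L) : H = L :=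
  Submodule.eq_of_le_of_finrank_eq h (by rw [hH, hL])

lemma Defines.exists_smul {a b : Fin 3 → K} {H : Submodule K (Fin 3 → K)} (ha0 : a ≠ 0)
    (ha : Defines a H) (hb : Defines b H) : ∃ c : K, b = c • a := by
  obtain ⟨i, hi⟩ := Function.ne_iff.1 ha0
  simp only [Pi.zero_apply] at hi
  refine ⟨b i / a i, ?_⟩
  funext j
  -- These vectors lie in the plane by antisymmetry; evaluating `b` on them gives proportionality
  -- with `a`.
  have h1 : (a j • Pi.single i (1 : K) - a i • Pi.single j (1 : K) : Fin 3 → K) ∈ H := by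
    rw [ha.mem_iff]
    simp [dotProduct_sub, dotProduct_smul, mul_comm]
  rw [hb.mem_iff] at h1
  simp [dotProduct_sub, dotProduct_smul] at h1
  simp only [Pi.smul_apply, smul_eq_mul]
  field_simp
  linear_combination -h1

lemma Defines.dvd_iff {a b : Fin 3 → K} {H : Submodule K (Fin 3 → K)} (ha0 : a ≠ 0)
    (ha : Defines a H) (hb : Defines b H) {P : Fin 3 → MvPolynomial (Fin 3) K}
    (h : linForm a ∣ dot a P) : linForm b ∣ dot b P := by
  obtain ⟨c, rfl⟩ := ha.exists_smul ha0 hb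
  rw [linForm_smul, dot_smul_left]
  exact mul_dvd_mul_left _ h

lemma Defines.dot_eq_zero {a b : Fin 3 → K} {H : Submodule K (Fin 3 → K)} (ha0 : a ≠ 0)
    (ha : Defines a H) (hb : Defines b H) {P : Fin 3 → MvPolynomial (Fin 3) K}
    (h : dot a P = 0) : dot b P = 0 := by
  obtain ⟨c, rfl⟩ := ha.exists_smul ha0 hb
  rw [dot_smul_left, h, mul_zero]

/-- The vector `w` becomes the point at infinity of `H`, so all intersection points get finite
parameters. It exists because a plane over an infinite field is not a finite union of proper
subspaces; including `⊥` among them makes `w` nonzero. -/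
lemma exists_mem_avoiding [Infinite K] {H : Submodule K (Fin 3 → K)}
    (hH : Module.finrank K H = 2) {A : Set (Submodule K (Fin 3 → K))} (hA : A.Finite)
    (hA2 : ∀ L ∈ A, Module.finrank K L = 2) (hHA : H ∉ A) :
    ∃ w ∈ H, w ≠ 0 ∧ ∀ L ∈ A, w ∉ L := by
  classical
  have h := Subspace.biUnion_ne_univ_of_top_notMem (k := K) (E := H)
    (s := insert ⊥ (hA.toFinset.image fun L => L.comap H.subtype)) (by
      simp only [Finset.mem_insert, Finset.mem_image, Set.Finite.mem_toFinset, not_or, not_exists,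
        not_and]
      refine ⟨fun h => ?_, fun L hL h => hHA ?_⟩
      · have := congrArg (fun X : Submodule K H => Module.finrank K X) h
        simp [hH] at this
      · have h1 : H ≤ L := fun x hx => by
          have : (⟨x, hx⟩ : H) ∈ L.comap H.subtype := h ▸ Submodule.mem_top
          exact this
        rwa [eq_of_le_of_plane hH (hA2 L hL) h1])
  obtain ⟨w, hw⟩ := (Set.ne_univ_iff_exists_notMem _).1 h
  simp only [Finset.mem_insert, Finset.mem_image, Set.Finite.mem_toFinset, Set.mem_iUnion,
    not_exists] at hw
  refine ⟨w, w.2, fun h0 => hw ⊥ (Or.inl rfl) ?_, fun L hL hwL => hw _ (Or.inr ⟨L, hL, rfl⟩) hwL⟩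
  simpa using h0

lemma exists_frame {H : Submodule K (Fin 3 → K)} (hH : Module.finrank K H = 2) {w : Fin 3 → K}
    (hw : w ∈ H) (hw0 : w ≠ 0) : ∃ a u, Defines a H ∧ Nonempty (Frame a u w) := by
  obtain ⟨a, ha0, ha⟩ := exists_defines hH
  obtain ⟨u, huH, hu⟩ : ∃ u ∈ H, u ∉ Submodule.span K {w} := by
    by_contra! hcon
    have h1 := Submodule.finrank_mono (show H ≤ Submodule.span K {w} from hcon)
    rw [hH, finrank_span_singleton hw0] at h1
    omega
  obtain ⟨e, he⟩ : ∃ e, a ⬝ᵥ e = 1 := by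
    obtain ⟨i, hi⟩ := Function.ne_iff.1 ha0
    exact ⟨Pi.single i (a i)⁻¹, by simpa using mul_inv_cancel₀ hi⟩
  rw [ha.mem_iff] at huH hw
  have hli : LinearIndependent K ![e, u, w] := by
    rw [Fintype.linearIndependent_iff]
    intro g hg
    simp only [Fin.sum_univ_three, Matrix.cons_val_zero, Matrix.cons_val_one,
      Matrix.cons_val] at hg
    have h0 : g 0 = 0 := by
      have := congrArg (a ⬝ᵥ ·) hg
      simpa [dotProduct_add, dotProduct_smul, he, huH, hw] using this
    have h1 : g 1 = 0 := by
      by_contra h1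
      refine hu (Submodule.mem_span_singleton.2 ⟨-(g 1)⁻¹ * g 2, ?_⟩)
      rw [h0, zero_smul, zero_add] at hg
      have : g 1 • u = -(g 2 • w) := eq_neg_of_add_eq_zero_left hg
      rw [← inv_smul_smul₀ h1 u, this]
      module
    have h2 : g 2 = 0 := by
      rw [h0, h1] at hg
      simpa [hw0] using hg
    intro i
    fin_cases i <;> assumption
  let B := basisOfLinearIndependentOfCardEqFinrank hli (by simp)
  have hB : ⇑B = ![e, u, w] := coe_basisOfLinearIndependentOfCardEqFinrank _ _
  have hdec : ∀ v : Fin 3 → K, v = B.repr v 0 • e + B.repr v 1 • u + B.repr v 2 • w := fun v => by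
    conv_lhs => rw [← B.sum_repr v]
    simp [Fin.sum_univ_three, hB]
  have ha' : ∀ v, B.repr v 0 = a ⬝ᵥ v := fun v => by
    conv_rhs => rw [hdec v]
    simp [dotProduct_add, dotProduct_smul, he, huH, hw]
  refine ⟨a, u, ha, ⟨{
    e := e
    s := fun i => B.repr (Pi.single i 1) 1
    t := fun i => B.repr (Pi.single i 1) 2
    au := huH
    aw := hw
    ae := he
    su := ?_
    decomp := fun i j => ?_ }⟩⟩
  · have h1 : B.repr u 1 = 1 := by
      have : u = B 1 := by simp [hB]
      rw [this, B.repr_self]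
      simp
    have h2 : u = ∑ i, u i • Pi.single i (1 : K) := by
      simp [← Pi.single_smul, Finset.univ_sum_single]
    have h3 : B.repr (∑ i, u i • Pi.single i (1 : K)) 1 = 1 := h2 ▸ h1
    simp only [map_sum, map_smul, Finsupp.coe_finsetSum, Finset.sum_apply, Finsupp.smul_apply,
      smul_eq_mul] at h3
    conv_rhs => rw [← h3]
    exact Finset.sum_congr rfl fun i _ => mul_comm _ _
  · have h1 := congrFun (hdec (Pi.single i 1)) j
    rw [ha'] at h1
    simp only [Pi.add_apply, Pi.smul_apply, smul_eq_mul, dotProduct_single, mul_one] at h1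
    rw [← h1, Pi.single_apply]
    simp [eq_comm]

/-! ### Charts: translating between subspaces and parameters -/

/-- The plane `H` with a frame, and normalized equations of the members of an arrangement `A` not
containing `H`. -/
structure Chart (A : Set (Submodule K (Fin 3 → K))) (H : Submodule K (Fin 3 → K)) where
  a : Fin 3 → K
  u : Fin 3 → K
  w : Fin 3 → K
  frame : Frame a u w
  defines : Defines a H
  eqn : Submodule K (Fin 3 → K) → Fin 3 → K
  eqn_defines : ∀ L ∈ A, Defines (eqn L) L
  eqn_w : ∀ L ∈ A, eqn L ⬝ᵥ w = 1
  finite : A.Finite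

lemma exists_chart [Infinite K] {H : Submodule K (Fin 3 → K)}
    (hH : Module.finrank K H = 2) {A : Set (Submodule K (Fin 3 → K))} (hA : A.Finite)
    (hA2 : ∀ L ∈ A, Module.finrank K L = 2) (hHA : H ∉ A) : Nonempty (Chart A H) := by
  obtain ⟨w, hwH, hw0, hwA⟩ := exists_mem_avoiding hH hA hA2 hHA
  obtain ⟨a, u, ha, ⟨F⟩⟩ := exists_frame hH hwH hw0
  have : ∀ L : Submodule K (Fin 3 → K), ∃ b, L ∈ A → Defines b L ∧ b ⬝ᵥ w = 1 := fun L => by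
    by_cases hL : L ∈ A
    · obtain ⟨b, -, hb⟩ := exists_defines (hA2 L hL)
      have hbw : b ⬝ᵥ w ≠ 0 := fun h => hwA L hL ((hb.mem_iff w).2 h)
      exact ⟨(b ⬝ᵥ w)⁻¹ • b, fun _ => ⟨hb.smul (inv_ne_zero hbw), by
        rw [smul_dotProduct, smul_eq_mul, inv_mul_cancel₀ hbw]⟩⟩
    · exact ⟨0, fun h => absurd h hL⟩
  choose b hb using this
  exact ⟨⟨a, u, w, F, ha, b, fun L hL => (hb L hL).1, fun L hL => (hb L hL).2, hA⟩⟩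

/-- Lets the same points be counted as parameters in `K`, as subspaces of `K ^ 3`, or as subspaces
of `H`. -/
lemma ncard_image_eq_of_iff {α β γ : Type*} {s : Set α} {f : α → β} {g : α → γ}
    (h : ∀ x ∈ s, ∀ y ∈ s, f x = f y ↔ g x = g y) : (f '' s).ncard = (g '' s).ncard := by
  refine Set.ncard_congr (fun b hb => g hb.choose) (fun b hb => ?_) (fun b b' hb hb' hbb => ?_)
    fun c hc => ?_
  · exact ⟨_, hb.choose_spec.1, rfl⟩
  · rw [← hb.choose_spec.2, ← hb'.choose_spec.2]
    exact (h _ hb.choose_spec.1 _ hb'.choose_spec.1).2 hbb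
  · obtain ⟨x, hx, rfl⟩ := hc
    have hb : f x ∈ f '' s := ⟨x, hx, rfl⟩
    exact ⟨f x, hb, (h _ hb.choose_spec.1 _ hx).1 hb.choose_spec.2⟩

/-- The points in which the members of `A` meet `H`. -/
def traces (A : Set (Submodule K (Fin 3 → K))) (H : Submodule K (Fin 3 → K)) :
    Set (Submodule K (Fin 3 → K)) :=
  (fun L => H ⊓ L) '' A

lemma restriction_eq_traces (A : Set (Submodule K (Fin 3 → K))) (H : Submodule K (Fin 3 → K)) :
    restriction A H = traces (A \ {H}) H := by
  ext X
  simp [restriction, traces, eq_comm]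

namespace Chart

variable {A : Set (Submodule K (Fin 3 → K))} {H : Submodule K (Fin 3 → K)} (c : Chart A H)

open Classical in
/-- The set of normalized equations. -/
def eqns : Finset (Fin 3 → K) := c.finite.toFinset.image c.eqn

lemma mem_eqns {b : Fin 3 → K} : b ∈ c.eqns ↔ ∃ L ∈ A, c.eqn L = b := by
  classical
  simp [eqns]

lemma eqns_w : ∀ b ∈ c.eqns, b ⬝ᵥ c.w = 1 := fun b hb => by
  obtain ⟨L, hL, rfl⟩ := c.mem_eqns.1 hb
  exact c.eqn_w L hL

lemma eqn_ne_zero {L : Submodule K (Fin 3 → K)} (hL : L ∈ A) : c.eqn L ≠ 0 := fun h => by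
  simpa [h] using c.eqn_w L hL

lemma eqn_injOn : Set.InjOn c.eqn A := fun L hL L' hL' h => by
  ext v
  rw [(c.eqn_defines L hL).mem_iff, (c.eqn_defines L' hL').mem_iff, h]

lemma card_eqns : c.eqns.card = A.ncard := by
  classical
  rw [eqns, Finset.card_image_of_injOn, Set.ncard_eq_toFinset_card _ c.finite]
  simpa using c.eqn_injOn

lemma param_eq_iff {L L' : Submodule K (Fin 3 → K)} (hL : L ∈ A) (hL' : L' ∈ A) :
    param c.u (c.eqn L) = param c.u (c.eqn L') ↔ H ⊓ L = H ⊓ L' := by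
  constructor
  · intro h
    have h1 := c.frame.eq_add_smul (c.eqn_w L hL) (c.eqn_w L' hL') h.symm
    ext v
    simp only [Submodule.mem_inf]
    refine and_congr_right fun hv => ?_
    rw [c.defines.mem_iff] at hv
    rw [(c.eqn_defines L hL).mem_iff, (c.eqn_defines L' hL').mem_iff, h1, add_dotProduct, smul_dotProduct,
      hv, smul_zero, add_zero]
  · intro h
    have h1 : c.u + param c.u (c.eqn L) • c.w ∈ H ⊓ L := by
      refine ⟨?_, ?_⟩
      · rw [SetLike.mem_coe, c.defines.mem_iff]
        simp [dotProduct_add, dotProduct_smul, c.frame.au, c.frame.aw]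
      · rw [SetLike.mem_coe, (c.eqn_defines L hL).mem_iff]
        simp [dotProduct_add, dotProduct_smul, c.eqn_w L hL, param]
    rw [h] at h1
    have h2 := ((c.eqn_defines L' hL').mem_iff _).1 h1.2
    simp only [dotProduct_add, dotProduct_smul, c.eqn_w L' hL', smul_eq_mul, mul_one] at h2
    rw [eq_neg_of_add_eq_zero_right h2]
    rfl

lemma card_params : (params c.u c.eqns).card = (traces A H).ncard := by
  classical
  have h1 : (params c.u c.eqns : Set K) = (fun L => param c.u (c.eqn L)) '' A := by
    ext q
    simp [params, eqns]
  rw [← Set.ncard_coe_finset, h1]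
  exact ncard_image_eq_of_iff fun L hL L' hL' => c.param_eq_iff hL hL'

/-- If the points of `H` lie on at least two other members of `A`, then each fibre has at least two
elements. -/
lemma two_le_fib (h : ∀ L ∈ A, ∃ L' ∈ A, L' ≠ L ∧ H ⊓ L' = H ⊓ L) :
    ∀ q ∈ params c.u c.eqns, 2 ≤ (fib c.u c.eqns q).card := by
  classical
  intro q hq
  obtain ⟨b, hb, rfl⟩ := Finset.mem_image.1 hq
  obtain ⟨L, hL, rfl⟩ := c.mem_eqns.1 hb
  obtain ⟨L', hL', hne, h'⟩ := h L hL
  refine Finset.one_lt_card.2 ⟨c.eqn L, Finset.mem_filter.2 ⟨hb, rfl⟩, c.eqn L',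
    Finset.mem_filter.2 ⟨c.mem_eqns.2 ⟨L', hL', rfl⟩, (c.param_eq_iff hL' hL).2 h'⟩, fun h => ?_⟩
  exact hne (c.eqn_injOn hL hL' h).symm

lemma two_mul_le (c : Chart A H) (h : ∀ L ∈ A, ∃ L' ∈ A, L' ≠ L ∧ H ⊓ L' = H ⊓ L) :
    2 * (traces A H).ncard ≤ A.ncard := by
  rw [← c.card_params, ← c.card_eqns, ← sum_card_fib c.u, mul_comm]
  have := Finset.card_nsmul_le_sum (params c.u c.eqns) (fun q => (fib c.u c.eqns q).card) 2
    (c.two_le_fib h)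
  simpa using this

end Chart

/-! ### Homogeneous logarithmic vector fields -/

/-- The vector fields with coefficients in `S_k`. -/
def homVec (K : Type u) [Field K] (k : ℕ) : Submodule K (Fin 3 → MvPolynomial (Fin 3) K) :=
  Submodule.pi Set.univ fun _ => homogeneousSubmodule (Fin 3) K k

lemma mem_homVec {k : ℕ} {P : Fin 3 → MvPolynomial (Fin 3) K} :
    P ∈ homVec K k ↔ ∀ i, (P i).IsHomogeneous k := by
  simp [homVec, Submodule.mem_pi]

/-- `homVec` as a power of `S_k`. -/
def homVecEquiv (K : Type u) [Field K] (k : ℕ) :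
    homVec K k ≃ₗ[K] (Fin 3 → homogeneousSubmodule (Fin 3) K k) where
  toFun P i := ⟨P.1 i, mem_homVec.1 P.2 i⟩
  invFun Q := ⟨fun i => Q i, mem_homVec.2 fun i => (Q i).2⟩
  map_add' _ _ := rfl
  map_smul' _ _ := rfl
  left_inv _ := rfl
  right_inv _ := rfl

instance finite_homVec (k : ℕ) : Module.Finite K (homVec K k) :=
  Module.Finite.equiv (homVecEquiv K k).symm

lemma finrank_homVec (k : ℕ) : Module.finrank K (homVec K k) =
    3 * Module.finrank K (homogeneousSubmodule (Fin 3) K k) := by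
  rw [(homVecEquiv K k).finrank_eq, Module.finrank_pi_fintype]
  simp

/-- The homogeneous vector fields of degree `k` tangent to the members of `A`. -/
def logVec (A : Set (Submodule K (Fin 3 → K))) (k : ℕ) :
    Submodule K (Fin 3 → MvPolynomial (Fin 3) K) where
  carrier := {P | P ∈ homVec K k ∧ ∀ H ∈ A, ∀ a, Defines a H → linForm a ∣ dot a P}
  add_mem' hP hQ := ⟨add_mem hP.1 hQ.1, fun H hH a ha => by
    rw [dot_add_right]
    exact dvd_add (hP.2 H hH a ha) (hQ.2 H hH a ha)⟩
  zero_mem' := ⟨zero_mem _, fun _ _ a _ => by simp [dot_zero_right]⟩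
  smul_mem' c P hP := ⟨Submodule.smul_mem _ c hP.1, fun H hH a ha => by
    rw [dot_C_smul_right, MvPolynomial.smul_eq_C_mul]
    exact (hP.2 H hH a ha).mul_left _⟩

lemma mem_logVec {A : Set (Submodule K (Fin 3 → K))} {k : ℕ}
    {P : Fin 3 → MvPolynomial (Fin 3) K} : P ∈ logVec A k ↔
      P ∈ homVec K k ∧ ∀ H ∈ A, ∀ a, Defines a H → linForm a ∣ dot a P := Iff.rfl

lemma logVec_le_homVec (A : Set (Submodule K (Fin 3 → K))) (k : ℕ) : logVec A k ≤ homVec K k :=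
  fun _ hP => hP.1

instance finite_logVec (A : Set (Submodule K (Fin 3 → K))) (k : ℕ) :
    Module.Finite K (logVec A k) :=
  Submodule.finiteDimensional_of_le (logVec_le_homVec A k)

lemma logVec_empty (k : ℕ) : logVec (∅ : Set (Submodule K (Fin 3 → K))) k = homVec K k := by
  ext P
  simp [mem_logVec]

lemma logVec_union (A B : Set (Submodule K (Fin 3 → K))) (k : ℕ) :
    logVec (A ∪ B) k = logVec A k ⊓ logVec B k := by
  ext P
  simp only [Submodule.mem_inf, mem_logVec, Set.mem_union]
  grind

lemma logVec_insert (A : Set (Submodule K (Fin 3 → K))) (H : Submodule K (Fin 3 → K)) (k : ℕ) :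
    logVec (insert H A) k = logVec A k ⊓ logVec {H} k := by
  rw [Set.insert_eq, Set.union_comm, logVec_union]

/-- The homogeneous vector fields of degree `k` annihilating the equation of `H`. -/
def killVec (H : Submodule K (Fin 3 → K)) (k : ℕ) :
    Submodule K (Fin 3 → MvPolynomial (Fin 3) K) where
  carrier := {P | P ∈ homVec K k ∧ ∀ a, Defines a H → dot a P = 0}
  add_mem' hP hQ := ⟨add_mem hP.1 hQ.1, fun a ha => by
    rw [dot_add_right, hP.2 a ha, hQ.2 a ha, add_zero]⟩
  zero_mem' := ⟨zero_mem _, fun a _ => dot_zero_right a⟩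
  smul_mem' c P hP := ⟨Submodule.smul_mem _ c hP.1, fun a ha => by
    rw [dot_C_smul_right, hP.2 a ha, smul_zero]⟩

lemma mem_killVec {H : Submodule K (Fin 3 → K)} {k : ℕ}
    {P : Fin 3 → MvPolynomial (Fin 3) K} : P ∈ killVec H k ↔
      P ∈ homVec K k ∧ ∀ a, Defines a H → dot a P = 0 := Iff.rfl

lemma killVec_le_logVec (H : Submodule K (Fin 3 → K)) (k : ℕ) : killVec H k ≤ logVec {H} k := by
  rintro P ⟨h1, h2⟩
  refine ⟨h1, ?_⟩
  rintro _ rfl a ha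
  simp [h2 a ha]

/-- The `K`-linear map `P ↦ dot a P`. -/
def dotₗ (a : Fin 3 → K) : (Fin 3 → MvPolynomial (Fin 3) K) →ₗ[K] MvPolynomial (Fin 3) K where
  toFun := dot a
  map_add' := dot_add_right a
  map_smul' c P := dot_C_smul_right a c P

/-- The form of rank-nullity used in every dimension count: the elements of `M` killed by `f` form
the part surviving the conditions, and `R` bounds the number of conditions. -/
lemma finrank_le_of_ker_le {V W : Type*} [AddCommGroup V] [Module K V] [AddCommGroup W]
    [Module K W] (f : V →ₗ[K] W) (M N : Submodule K V) (R : Submodule K W) [Module.Finite K M]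
    [Module.Finite K N] [Module.Finite K R]
    (hR : ∀ x ∈ M, f x ∈ R) (hN : ∀ x ∈ M, f x = 0 → x ∈ N) :
    Module.finrank K M ≤ Module.finrank K N + Module.finrank K R := by
  have h1 := (f.domRestrict M).finrank_range_add_finrank_ker
  have h2 : Module.finrank K (LinearMap.range (f.domRestrict M)) ≤ Module.finrank K R := by
    refine Submodule.finrank_mono ?_
    rintro _ ⟨x, rfl⟩
    exact hR x x.2
  have h3 : Module.finrank K (LinearMap.ker (f.domRestrict M)) ≤ Module.finrank K N := by
    rw [← Submodule.finrank_map_subtype_eq]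
    refine Submodule.finrank_mono ?_
    rintro _ ⟨x, hx, rfl⟩
    exact hN x x.2 hx
  omega

lemma two_mul_le_finrank_killVec {H : Submodule K (Fin 3 → K)} (hH : Module.finrank K H = 2)
    (k : ℕ) : 2 * Module.finrank K (homogeneousSubmodule (Fin 3) K k) ≤
      Module.finrank K (killVec H k) := by
  obtain ⟨a, ha0, ha⟩ := exists_defines hH
  have : Module.Finite K (killVec H k) :=
    Submodule.finiteDimensional_of_le (S₂ := homVec K k) fun _ hP => hP.1
  have h := finrank_le_of_ker_le (dotₗ a) (homVec K k) (killVec H k)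
    (homogeneousSubmodule (Fin 3) K k) (fun P hP => dot_homogeneous (mem_homVec.1 hP))
    fun P hP h0 => ⟨hP, fun b hb => ha.dot_eq_zero ha0 hb h0⟩
  rw [finrank_homVec] at h
  omega

lemma Chart.logOn {A : Set (Submodule K (Fin 3 → K))} {H : Submodule K (Fin 3 → K)}
    (c : Chart A H) {k : ℕ} {P : Fin 3 → MvPolynomial (Fin 3) K} (hP : P ∈ logVec A k) :
    LogOn c.eqns P := fun b hb => by
  obtain ⟨L, hL, rfl⟩ := c.mem_eqns.1 hb
  exact hP.2 L hL _ (c.eqn_defines L hL)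

lemma finrank_degreeLT (n : ℕ) : Module.finrank K (Polynomial.degreeLT K n) = n := by
  rw [(Polynomial.degreeLTEquiv K n).finrank_eq, Module.finrank_fin_fun]

instance finite_degreeLT (n : ℕ) : Module.Finite K (Polynomial.degreeLT K n) :=
  Module.Finite.equiv (Polynomial.degreeLTEquiv K n).symm

/-- The polynomials of degree at most `k` divisible by a monic polynomial `B` form a space of
dimension at most `k + 1 - deg B`. -/
lemma mem_map_mul_degreeLT {B p : Polynomial K} (hB : B.Monic) {k : ℕ}
    (hp : p.natDegree ≤ k) (h : B ∣ p) :
    p ∈ (Polynomial.degreeLT K (k + 1 - B.natDegree)).map (LinearMap.mulLeft K B) := by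
  obtain ⟨q, rfl⟩ := h
  refine ⟨q, ?_, rfl⟩
  by_cases hq : q = 0
  · simp [hq]
  rw [hB.natDegree_mul' hq] at hp
  rw [SetLike.mem_coe, Polynomial.mem_degreeLT, Polynomial.degree_eq_natDegree hq]
  exact_mod_cast (by omega : q.natDegree < k + 1 - B.natDegree)

/-- The exceptional divisor of the restriction of vector fields tangent to `A` to the plane `H`. -/
lemma Chart.prod_dvd {A : Set (Submodule K (Fin 3 → K))} {H : Submodule K (Fin 3 → K)}
    (c : Chart A H) : ∃ B : Polynomial K, B.Monic ∧
      B.natDegree = A.ncard - (traces A H).ncard ∧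
      ∀ k, ∀ P ∈ logVec A k, B ∣ ev c.u c.w (dot c.a P) := by
  refine ⟨_, Polynomial.monic_prod_of_monic _ _ fun q _ => (Polynomial.monic_X_sub_C q).pow _, ?_,
    fun k P hP => c.frame.prod_dvd_ev c.eqns_w (c.logOn hP)⟩
  rw [natDegree_prod_pow, sum_card_fib_sub_one, c.card_eqns, c.card_params]

lemma mem_logVec_singleton_iff [Infinite K] {A : Set (Submodule K (Fin 3 → K))}
    {H : Submodule K (Fin 3 → K)} (c : Chart A H) {k : ℕ} {P : Fin 3 → MvPolynomial (Fin 3) K}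
    (hP : P ∈ homVec K k) : P ∈ logVec {H} k ↔ ev c.u c.w (dot c.a P) = 0 := by
  rw [c.frame.ev_eq_zero_iff (dot_homogeneous (mem_homVec.1 hP)), mem_logVec]
  simp only [hP, true_and, Set.mem_singleton_iff, forall_eq]
  exact ⟨fun h => h _ c.defines, fun h b hb => c.defines.dvd_iff c.frame.a_ne_zero hb h⟩

lemma traces_ncard_le {A : Set (Submodule K (Fin 3 → K))} (hA : A.Finite)
    (H : Submodule K (Fin 3 → K)) : (traces A H).ncard ≤ A.ncard :=
  Set.ncard_image_le hA

/-- Adding the plane `H` to `A` imposes at most `k + 1 - (|A| - |traces A H|)` linear conditions on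
vector fields of degree `k`. -/
lemma finrank_le_add_of_le_logVec [Infinite K] {A : Set (Submodule K (Fin 3 → K))}
    {H : Submodule K (Fin 3 → K)} (hA : A.Finite) (hA2 : ∀ L ∈ A, Module.finrank K L = 2)
    (hH : Module.finrank K H = 2) (hHA : H ∉ A) {k : ℕ}
    {M : Submodule K (Fin 3 → MvPolynomial (Fin 3) K)} (hM : M ≤ logVec A k) :
    Module.finrank K M ≤ Module.finrank K (M ⊓ logVec {H} k : Submodule K _) +
      (k + 1 + (traces A H).ncard - A.ncard) := by
  obtain ⟨c⟩ := exists_chart hH hA hA2 hHA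
  obtain ⟨B, hB, hdeg, hdvd⟩ := c.prod_dvd
  have : Module.Finite K M := Submodule.finiteDimensional_of_le hM
  have h := finrank_le_of_ker_le ((ev c.u c.w).toLinearMap ∘ₗ dotₗ c.a) M
    (M ⊓ logVec {H} k) ((Polynomial.degreeLT K (k + 1 - B.natDegree)).map (LinearMap.mulLeft K B))
    (fun P hP => mem_map_mul_degreeLT hB
      (natDegree_ev_le _ _ (dot_homogeneous (mem_homVec.1 (hM hP).1))) (hdvd k P (hM hP)))
    fun P hP h0 => ⟨hP, (mem_logVec_singleton_iff c (hM hP).1).2 h0⟩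
  have h2 := Submodule.finrank_map_le (LinearMap.mulLeft K B)
    (Polynomial.degreeLT K (k + 1 - B.natDegree))
  rw [finrank_degreeLT] at h2
  have := traces_ncard_le hA H
  omega

/-- In degrees `k < |A| - |traces A H|`, vector fields tangent to `A` are tangent to `H`. -/
lemma logVec_le_of_lt [Infinite K] {A : Set (Submodule K (Fin 3 → K))}
    {H : Submodule K (Fin 3 → K)} (c : Chart A H) {k : ℕ}
    (hk : k + (traces A H).ncard < A.ncard) : logVec A k ≤ logVec {H} k := fun P hP => by
  obtain ⟨B, hB, hdeg, hdvd⟩ := c.prod_dvd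
  rw [mem_logVec_singleton_iff c hP.1]
  refine Polynomial.eq_zero_of_dvd_of_natDegree_lt (hdvd k P hP) ?_
  refine (natDegree_ev_le _ _ (dot_homogeneous (mem_homVec.1 hP.1))).trans_lt ?_
  omega

/-- `NoDoubleOn A H`: no point of `A` on `H` is a double point. -/
def NoDoubleOn (A : Set (Submodule K (Fin 3 → K))) (H : Submodule K (Fin 3 → K)) : Prop :=
  ∀ L ∈ A \ {H}, ∃ L' ∈ A \ {H}, L' ≠ L ∧ H ⊓ L' = H ⊓ L

lemma logVec_mono {A B : Set (Submodule K (Fin 3 → K))} (h : A ⊆ B) (k : ℕ) :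
    logVec B k ≤ logVec A k := fun _ hP => ⟨hP.1, fun H hH => hP.2 H (h hH)⟩

/-- If `H` contains no double point, then a nonzero vector field tangent to `A` and annihilating the
equation of `H` has degree at least `|A^H|`. -/
lemma eq_bot_of_lt_traces [CharZero K] {A : Set (Submodule K (Fin 3 → K))} (hA : A.Finite)
    (hA2 : ∀ L ∈ A, Module.finrank K L = 2) {H : Submodule K (Fin 3 → K)} (hH : H ∈ A)
    (hd : NoDoubleOn A H) (h2 : 2 ≤ (traces (A \ {H}) H).ncard) {d : ℕ}
    (hlt : d < (traces (A \ {H}) H).ncard) : logVec A d ⊓ killVec H d = ⊥ := by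
  obtain ⟨c⟩ := exists_chart (hA2 H hH) (hA.sdiff (t := {H})) (fun L hL => hA2 L hL.1)
    (fun h => h.2 rfl)
  rw [eq_bot_iff]
  rintro P ⟨hP, hk⟩
  rw [← c.card_params] at hlt h2
  exact c.frame.eq_zero_of_lt c.eqns_w (c.two_le_fib hd) h2 d hlt P (mem_homVec.1 hP.1)
    (c.logOn (logVec_mono Set.sdiff_subset d hP)) (hk.2 _ c.defines)

/-- Subtracting a multiple of the Euler field, a vector field tangent to `A` can be made to
annihilate the equation of `H ∈ A`. -/
lemma exists_mem_killVec {A : Set (Submodule K (Fin 3 → K))} {H : Submodule K (Fin 3 → K)}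
    (hH2 : Module.finrank K H = 2) (hH : H ∈ A) {d : ℕ} {P : Fin 3 → MvPolynomial (Fin 3) K}
    (hP : P ∈ logVec A d) (h0 : ∀ g : MvPolynomial (Fin 3) K, P ≠ g • X) :
    logVec A d ⊓ killVec H d ≠ ⊥ := by
  obtain ⟨a, ha0, ha⟩ := exists_defines hH2
  have hdvd := hP.2 H hH a ha
  have hom := dot_homogeneous (a := a) (mem_homVec.1 hP.1)
  obtain ⟨g, hg, hag⟩ : ∃ g : MvPolynomial (Fin 3) K,
      (∀ i : Fin 3, (g * X i).IsHomogeneous d) ∧ dot a P = linForm a * g := by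
    -- In degree zero there is no quotient of degree `d - 1`, but a constant divisible by a linear
    -- form vanishes.
    rcases d with _ | d
    · exact ⟨0, fun i => by simpa using isHomogeneous_zero _ _ _, by
        rw [eq_zero_of_linForm_dvd_of_homogeneous_zero ha0 hom hdvd, mul_zero]⟩
    · obtain ⟨g, hg, h⟩ := exists_homogeneous_factor hom hdvd
      exact ⟨g, fun i => hg.mul (isHomogeneous_X K i), h⟩
  have hQ : P - g • X ∈ homVec K d := sub_mem hP.1 (mem_homVec.2 hg)
  have hdot : ∀ b, dot b (P - g • X) = dot b P - g * linForm b := fun b => by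
    rw [sub_eq_add_neg, ← neg_smul, dot_add_right, dot_smul_right, dot_X]
    ring
  refine (Submodule.ne_bot_iff _).2 ⟨P - g • X, ⟨⟨hQ, fun L hL b hb => ?_⟩, hQ, fun b hb => ?_⟩,
    sub_ne_zero.2 (h0 g)⟩
  · rw [hdot]
    exact dvd_sub (hP.2 L hL b hb) (dvd_mul_left _ _)
  · refine ha.dot_eq_zero ha0 hb ?_
    rw [hdot, hag, mul_comm, sub_self]

lemma ne_smul_X_of_mem_killVec {H : Submodule K (Fin 3 → K)} (hH2 : Module.finrank K H = 2)
    {d : ℕ} {P : Fin 3 → MvPolynomial (Fin 3) K} (hP : P ∈ killVec H d) (h0 : P ≠ 0)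
    (g : MvPolynomial (Fin 3) K) : P ≠ g • X := by
  rintro rfl
  obtain ⟨a, ha0, ha⟩ := exists_defines hH2
  have := hP.2 a ha
  rw [dot_smul_right, dot_X, mul_eq_zero, or_iff_left (linForm_ne_zero ha0)] at this
  exact h0 (by rw [this, zero_smul])

/-- Whether `D_H(A)` has a nonzero element of degree `d` does not depend on `H`. -/
lemma killVec_ne_bot_of_ne_bot {A : Set (Submodule K (Fin 3 → K))}
    {H L : Submodule K (Fin 3 → K)} (hH2 : Module.finrank K H = 2)
    (hL2 : Module.finrank K L = 2) (hL : L ∈ A) {d : ℕ} (h : logVec A d ⊓ killVec H d ≠ ⊥) :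
    logVec A d ⊓ killVec L d ≠ ⊥ := by
  obtain ⟨P, hP, h0⟩ := (Submodule.ne_bot_iff _).1 h
  exact exists_mem_killVec hL2 hL hP.1 (ne_smul_X_of_mem_killVec hH2 hP.2 h0)

/-! ### Points as pairwise intersections, and double points -/

/-! ### Points -/

section Points

variable {A : Set (Submodule K (Fin 3 → K))}

lemma eq_of_le_of_finrank_one {p q : Submodule K (Fin 3 → K)} (hp : Module.finrank K p = 1)
    (hq : Module.finrank K q = 1) (h : p ≤ q) : p = q :=
  Submodule.eq_of_le_of_finrank_eq h (by rw [hp, hq])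

lemma mem_points_iff (hA2 : ∀ L ∈ A, Module.finrank K L = 2) {X : Submodule K (Fin 3 → K)} :
    X ∈ points A ↔ ∃ H ∈ A, ∃ L ∈ A, H ≠ L ∧ X = H ⊓ L := by
  constructor
  · rintro ⟨⟨B, hB, rfl⟩, h1⟩
    by_cases hs : B.Subsingleton
    · rcases hs.eq_empty_or_singleton with rfl | ⟨H, rfl⟩
      · rw [sInf_empty, finrank_top, Module.finrank_fin_fun] at h1
        omega
      · rw [sInf_singleton, hA2 H (hB rfl)] at h1
        omega
    · rw [Set.not_subsingleton_iff] at hs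
      obtain ⟨H, hH, L, hL, hne⟩ := hs
      exact ⟨H, hB hH, L, hB hL, hne, eq_of_le_of_finrank_one h1
        (finrank_inf_of_ne (hA2 H (hB hH)) (hA2 L (hB hL)) hne)
        (le_inf (sInf_le hH) (sInf_le hL))⟩
  · rintro ⟨H, hH, L, hL, hne, rfl⟩
    refine ⟨⟨{H, L}, ?_, sInf_pair.symm⟩, finrank_inf_of_ne (hA2 H hH) (hA2 L hL) hne⟩
    rintro X (rfl | rfl) <;> assumption

lemma finite_points (hA : A.Finite) (hA2 : ∀ L ∈ A, Module.finrank K L = 2) :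
    (points A).Finite := by
  refine ((hA.prod hA).image fun x => x.1 ⊓ x.2).subset fun X hX => ?_
  obtain ⟨H, hH, L, hL, -, rfl⟩ := (mem_points_iff hA2).1 hX
  exact ⟨(H, L), ⟨hH, hL⟩, rfl⟩

lemma mem_points_of_two (hA2 : ∀ L ∈ A, Module.finrank K L = 2) {p H L : Submodule K (Fin 3 → K)}
    (hp : Module.finrank K p = 1) (hH : H ∈ A) (hL : L ∈ A) (hne : H ≠ L) (hpH : p ≤ H)
    (hpL : p ≤ L) : p ∈ points A :=
  (mem_points_iff hA2).2 ⟨H, hH, L, hL, hne, eq_of_le_of_finrank_one hp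
    (finrank_inf_of_ne (hA2 H hH) (hA2 L hL) hne) (le_inf hpH hpL)⟩

/-- If `X ≤ L'` is the intersection of `H` with `L`, then it is the intersection of `H` with
`L'`. -/
lemma inf_eq_inf_of_le {H L L' : Submodule K (Fin 3 → K)} (hH : Module.finrank K H = 2)
    (hL : Module.finrank K L = 2) (hL' : Module.finrank K L' = 2) (h : H ≠ L) (h' : H ≠ L')
    (hle : H ⊓ L ≤ L') : H ⊓ L = H ⊓ L' :=
  eq_of_le_of_finrank_one (finrank_inf_of_ne hH hL h) (finrank_inf_of_ne hH hL' h')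
    (le_inf inf_le_left hle)

/-- If only `H` and `L` passed through `H ⊓ L`, this point would be double. -/
lemma noDoubleOn_of_mu_ne (hA2 : ∀ L ∈ A, Module.finrank K L = 2)
    (h : ∀ p ∈ points A, mu A p ≠ 1) {H : Submodule K (Fin 3 → K)} (hH : H ∈ A) :
    NoDoubleOn A H := by
  rintro L ⟨hL, hLH⟩
  have hLH : L ≠ H := hLH
  by_contra! hcon
  refine h _ ((mem_points_iff hA2).2 ⟨H, hH, L, hL, hLH.symm, rfl⟩) ?_
  have : through A (H ⊓ L) = {H, L} := by
    ext L'
    constructor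
    · rintro ⟨hL', hle⟩
      by_contra hne
      simp only [Set.mem_insert_iff, Set.mem_singleton_iff, not_or] at hne
      exact hcon L' ⟨hL', hne.1⟩ hne.2 (inf_eq_inf_of_le (hA2 H hH) (hA2 L hL) (hA2 L' hL')
        hLH.symm (Ne.symm hne.1) hle).symm
    · rintro (rfl | rfl)
      · exact ⟨hH, inf_le_left⟩
      · exact ⟨hL, inf_le_right⟩
  rw [mu, this, Set.ncard_pair hLH.symm]
  norm_num

lemma n2_pos_iff (hA : A.Finite) (hA2 : ∀ L ∈ A, Module.finrank K L = 2) :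
    0 < n2 A ↔ ∃ p ∈ points A, mu A p = 1 := by
  rw [n2, Set.ncard_pos ((finite_points hA hA2).subset fun p hp => hp.1)]
  rfl

/-- The lines through a point `p` meet a line not through `p` in distinct points. -/
lemma ncard_traces_of_through {C : Set (Submodule K (Fin 3 → K))}
    (hC2 : ∀ L ∈ C, Module.finrank K L = 2) {p H : Submodule K (Fin 3 → K)}
    (hp : Module.finrank K p = 1) (hpC : ∀ L ∈ C, p ≤ L) (hH : Module.finrank K H = 2)
    (hpH : ¬ p ≤ H) : (traces C H).ncard = C.ncard := by
  refine Set.InjOn.ncard_image fun L hL L' hL' h => ?_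
  by_contra hne
  have hHL : H ≠ L := fun h => hpH (h ▸ hpC L hL)
  have h1 : p = L ⊓ L' := eq_of_le_of_finrank_one hp
    (finrank_inf_of_ne (hC2 L hL) (hC2 L' hL') hne) (le_inf (hpC L hL) (hpC L' hL'))
  have h2 : H ⊓ L ≤ L' := by
    have h3 : H ⊓ L = H ⊓ L' := h
    rw [h3]
    exact inf_le_right
  have h4 : H ⊓ L = p := by
    rw [h1]
    exact eq_of_le_of_finrank_one (finrank_inf_of_ne hH (hC2 L hL) hHL) (h1 ▸ hp)
      (le_inf inf_le_right h2)
  exact hpH (h4 ▸ inf_le_left)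

lemma finite_traces (hA : A.Finite) (H : Submodule K (Fin 3 → K)) : (traces A H).Finite :=
  hA.image _

lemma traces_mono {B : Set (Submodule K (Fin 3 → K))} (h : A ⊆ B) (H : Submodule K (Fin 3 → K)) :
    traces A H ⊆ traces B H :=
  Set.image_mono h

end Points

namespace IsProjectiveLineArrangement

variable {A : Set (Submodule K (Fin 3 → K))}

lemma exists_not_le (hA : IsProjectiveLineArrangement A)
    {p : Submodule K (Fin 3 → K)} (hp : p ≠ ⊥) : ∃ H ∈ A, ¬ p ≤ H := by
  by_contra! hcon
  obtain ⟨B, hB, h⟩ := hA.essential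
  exact hp (le_bot_iff.1 (h ▸ le_sInf fun H hH => hcon H (hB hH)))

lemma exists_not_le_of_finrank_one (hA : IsProjectiveLineArrangement A)
    {p : Submodule K (Fin 3 → K)} (hp : Module.finrank K p = 1) :
    ∃ H ∈ A, ¬ p ≤ H :=
  hA.exists_not_le fun h => by
    rw [h, finrank_bot] at hp
    omega

lemma exists_ne (hA : IsProjectiveLineArrangement A)
    {H : Submodule K (Fin 3 → K)} (hH : H ∈ A) : ∃ L ∈ A, L ≠ H := by
  obtain ⟨L, hL, h⟩ := hA.exists_not_le (p := H) fun h => by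
    have := hA.finrank_eq_two H hH
    rw [h, finrank_bot] at this
    omega
  exact ⟨L, hL, fun h' => h h'.ge⟩

lemma nonempty (hA : IsProjectiveLineArrangement A) : A.Nonempty := by
  obtain ⟨H, hH, -⟩ := hA.exists_not_le (p := ⊤) fun h => by
    have := congrArg (fun X : Submodule K (Fin 3 → K) => Module.finrank K X) h
    simp at this
  exact ⟨H, hH⟩

/-- If all lines met `H` in a single point, that point would lie on every line, against
essentiality. -/
lemma two_le_traces (hA : IsProjectiveLineArrangement A)
    {H : Submodule K (Fin 3 → K)} (hH : H ∈ A) :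
    2 ≤ (traces (A \ {H}) H).ncard := by
  obtain ⟨L, hL, hLH⟩ := hA.exists_ne hH
  have h1 := finrank_inf_of_ne (hA.finrank_eq_two H hH) (hA.finrank_eq_two L hL) hLH.symm
  obtain ⟨L', hL', h'⟩ := hA.exists_not_le_of_finrank_one h1
  refine (Set.one_lt_ncard (finite_traces (hA.finite.sdiff (t := {H})) H)).2
    ⟨H ⊓ L, ⟨L, ⟨hL, hLH⟩, rfl⟩, H ⊓ L', ⟨L', ⟨hL', fun h => ?_⟩, rfl⟩, fun h => h' ?_⟩
  · rw [Set.mem_singleton_iff] at h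
    exact h' (h ▸ inf_le_left)
  · rw [h]; exact inf_le_right

lemma chart [Infinite K] (hA : IsProjectiveLineArrangement A)
    {H : Submodule K (Fin 3 → K)} (hH : H ∈ A) :
    Nonempty (Chart (A \ {H}) H) :=
  exists_chart (hA.finrank_eq_two H hH) (hA.finite.sdiff (t := {H}))
    (fun L hL => hA.finrank_eq_two L hL.1) (fun h => h.2 rfl)

lemma eq_bot_of_lt [CharZero K] (hA : IsProjectiveLineArrangement A)
    {H : Submodule K (Fin 3 → K)} (hH : H ∈ A)
    (hd : NoDoubleOn A H) {d : ℕ} (hlt : d < (traces (A \ {H}) H).ncard) :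
    logVec A d ⊓ killVec H d = ⊥ :=
  eq_bot_of_lt_traces hA.finite hA.finrank_eq_two hH hd (hA.two_le_traces hH) hlt

/-- A line with more points than the degree of some nonzero vector field in `D_L(A)` contains a
double point. -/
lemma not_noDoubleOn_of_lt [CharZero K] (hA : IsProjectiveLineArrangement A)
    {H L : Submodule K (Fin 3 → K)} (hH : H ∈ A)
    (hL : Module.finrank K L = 2) {d : ℕ} (h : logVec A d ⊓ killVec L d ≠ ⊥)
    (hlt : d < (traces (A \ {H}) H).ncard) : ¬ NoDoubleOn A H := fun hd =>
  killVec_ne_bot_of_ne_bot hL (hA.finrank_eq_two H hH) hH h (hA.eq_bot_of_lt hH hd hlt)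

/-- If at least `|A| / 2` lines other than `H` pass through the point `p` of `H`, then a line avoiding
`p` contains a double point. -/
lemma not_noDoubleOn_of_multiplicity [Infinite K] (hA : IsProjectiveLineArrangement A)
    {H p : Submodule K (Fin 3 → K)} (hH : H ∈ A)
    (hp : p ∈ restriction A H) (h : A.ncard ≤ 2 * multiplicity A H p) :
    ∃ L ∈ A, ¬ NoDoubleOn A L := by
  obtain ⟨L, ⟨hL, hLH⟩, rfl⟩ := hp
  have hLH : L ≠ H := hLH
  have h1 := finrank_inf_of_ne (hA.finrank_eq_two H hH) (hA.finrank_eq_two L hL) hLH.symm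
  obtain ⟨L', hL', h'⟩ := hA.exists_not_le_of_finrank_one h1
  refine ⟨L', hL', fun hd => ?_⟩
  obtain ⟨c⟩ := hA.chart hL'
  have h2 := c.two_mul_le hd
  set C := {M | M ∈ A \ {H} ∧ M ⊓ H = H ⊓ L} with hC
  have hCA : insert H C ⊆ A := by
    rintro M (rfl | hM)
    exacts [hH, hM.1.1]
  have hCle : ∀ M ∈ insert H C, H ⊓ L ≤ M := by
    rintro M (rfl | hM)
    · exact inf_le_left
    · rw [← hM.2]
      exact inf_le_left
  have hsub : insert H C ⊆ A \ {L'} := fun M hM => ⟨hCA hM, by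
    rintro rfl
    exact h' (hCle _ hM)⟩
  have hfin := hA.finite.sdiff (t := {L'})
  -- The lines through the point cut `L'` in distinct points, whereas without double points `L'` has
  -- at most `(|A| - 1) / 2` of them.
  have h3 := Set.ncard_le_ncard (traces_mono hsub L') (finite_traces hfin L')
  rw [ncard_traces_of_through (fun M hM => hA.finrank_eq_two M (hCA hM)) h1 hCle
    (hA.finrank_eq_two L' hL') h', Set.ncard_insert_of_notMem (fun h => h.1.2 rfl)
    (hA.finite.subset fun M hM => hM.1.1)] at h3
  have h4 := Set.ncard_sdiff_singleton_add_one hL' hA.finite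
  rw [multiplicity, ← hC] at h
  omega

end IsProjectiveLineArrangement

/-! ### Adding several lines -/

/-- Iterated estimate for the number of linear conditions imposed by the lines of `T`, if each of
them has at most `r` points at each stage. -/
lemma finrank_le_add_sum [Infinite K] {A : Set (Submodule K (Fin 3 → K))} (hA : A.Finite)
    (hA2 : ∀ L ∈ A, Module.finrank K L = 2) {T : Set (Submodule K (Fin 3 → K))} (hT : T.Finite)
    (hT2 : ∀ L ∈ T, Module.finrank K L = 2) (hd : Disjoint A T) {k r : ℕ}
    (hr : ∀ L ∈ T, (traces ((A ∪ T) \ {L}) L).ncard ≤ r)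
    {M : Submodule K (Fin 3 → MvPolynomial (Fin 3) K)} (hM : M ≤ logVec A k) :
    Module.finrank K M ≤ Module.finrank K (M ⊓ logVec T k : Submodule K _) +
      ∑ j ∈ Finset.range T.ncard, (k + 1 + r - (A.ncard + j)) := by
  induction T, hT using Set.Finite.induction_on with
  | empty => rw [logVec_empty, inf_eq_left.2 (hM.trans (logVec_le_homVec A k))]; omega
  | @insert H T hHT hT ih =>
    have hd' := hd.mono_right (Set.subset_insert H T)
    have hHA : H ∉ A ∪ T := fun h => h.elim
      (fun h => Set.disjoint_left.1 hd h (Set.mem_insert H T)) hHT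
    have h1 := ih (fun L hL => hT2 L (Set.mem_insert_of_mem _ hL)) hd' fun L hL =>
      (Set.ncard_le_ncard (traces_mono (by gcongr; exact Set.subset_insert H T) L)
        (finite_traces ((hA.union (hT.insert H)).sdiff (t := {L})) L)).trans
        (hr L (Set.mem_insert_of_mem _ hL))
    have h2 := finrank_le_add_of_le_logVec (hA.union hT) (fun L hL => hL.elim (hA2 L) fun h =>
      hT2 L (Set.mem_insert_of_mem _ h)) (hT2 H (Set.mem_insert H T)) hHA
      (k := k) (M := M ⊓ logVec T k) (by rw [logVec_union]; exact inf_le_inf_right _ hM)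
    have h3 : (traces (A ∪ T) H).ncard ≤ r := by
      have : (A ∪ insert H T) \ {H} = A ∪ T := by
        rw [Set.union_insert, Set.insert_sdiff_self_of_notMem hHA]
      exact this ▸ hr H (Set.mem_insert H T)
    rw [Set.ncard_union_eq hd' hA hT] at h2
    rw [Set.ncard_insert_of_notMem hHT hT, Finset.sum_range_succ, logVec_insert, ← inf_assoc]
    omega

/-- The naive estimate: each line imposes at most `k + 1` conditions. -/
lemma finrank_le_add_mul [Infinite K] {T : Set (Submodule K (Fin 3 → K))} (hT : T.Finite)
    (hT2 : ∀ L ∈ T, Module.finrank K L = 2) {k : ℕ}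
    {M : Submodule K (Fin 3 → MvPolynomial (Fin 3) K)} (hM : M ≤ homVec K k) :
    Module.finrank K M ≤ Module.finrank K (M ⊓ logVec T k : Submodule K _) +
      T.ncard * (k + 1) := by
  induction T, hT using Set.Finite.induction_on with
  | empty => rw [logVec_empty, inf_eq_left.2 hM]; omega
  | @insert H T hHT hT ih =>
    have h1 := ih fun L hL => hT2 L (Set.mem_insert_of_mem _ hL)
    have h2 := finrank_le_add_of_le_logVec hT (fun L hL => hT2 L (Set.mem_insert_of_mem _ hL))
      (hT2 H (Set.mem_insert H T)) hHT (k := k) (M := M ⊓ logVec T k) inf_le_right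
    have h3 := traces_ncard_le hT H
    rw [Set.ncard_insert_of_notMem hHT hT, logVec_insert, ← inf_assoc, add_mul, one_mul]
    omega

/-- Successive lines impose `m, m - 1, …` conditions, and none once this reaches zero. With
truncated subtraction the total is at most `m (m + 1) / 2` for any number of lines. -/
lemma two_mul_sum_range_sub (m N : ℕ) :
    2 * ∑ j ∈ Finset.range N, (m - j) + (m - N) * (m - N + 1) = m * (m + 1) := by
  induction N with
  | zero => simp
  | succ N ih =>
    rw [Finset.sum_range_succ]
    rcases Nat.lt_or_ge N m with h | h
    · obtain ⟨t, rfl⟩ : ∃ t, m = N + 1 + t := ⟨m - (N + 1), by omega⟩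
      rw [show N + 1 + t - N = t + 1 by omega] at *
      rw [show N + 1 + t - (N + 1) = t by omega]
      nlinarith
    · rw [Nat.sub_eq_zero_of_le h] at *
      rw [Nat.sub_eq_zero_of_le (by omega : m ≤ N + 1)]
      omega

/-! ### Supersolvable arrangements -/

/-- A supersolvable arrangement with a modular point of multiplicity `m` has a nonzero logarithmic
vector field of degree `m - 1` annihilating the equation of a line. -/
lemma IsModularPoint.exists_vec [Infinite K] {B : Set (Submodule K (Fin 3 → K))}
    (hB : B.Finite) (hB2 : ∀ L ∈ B, Module.finrank K L = 2) {p : Submodule K (Fin 3 → K)}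
    (hp : IsModularPoint B p) : ∃ H ∈ through B p,
      logVec B ((through B p).ncard - 1) ⊓ killVec H ((through B p).ncard - 1) ≠ ⊥ := by
  obtain ⟨hpB, hmod⟩ := hp
  have hp1 : Module.finrank K p = 1 := hpB.2
  obtain ⟨H, hH, L, hL, hHL, hpHL⟩ := (mem_points_iff hB2).1 hpB
  have hHp : H ∈ through B p := ⟨hH, hpHL ▸ inf_le_left⟩
  have hsub : through B p ⊆ B := fun L hL => hL.1
  have hfin : (through B p).Finite := hB.subset hsub
  refine ⟨H, hHp, fun hbot => ?_⟩
  set m := (through B p).ncard with hm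
  have hmpos : 0 < m := (Set.ncard_pos hfin).2 ⟨H, hHp⟩
  -- The other `m - 1` lines through `p` are added to `H`. They all meet in `p`, so `r = 1` and they
  -- impose at most `m, m - 1, …, 2` conditions.
  have h1 := finrank_le_add_sum (A := {H}) (T := through B p \ {H}) (k := m - 1) (r := 1)
    (Set.finite_singleton H) (by rintro _ rfl; exact hB2 _ hH) (hfin.sdiff (t := {H}))
    (fun L hL => hB2 L hL.1.1) Set.disjoint_sdiff_right (fun L hL => by
      have : traces (({H} ∪ through B p \ {H}) \ {L}) L ⊆ {p} := by
        rintro _ ⟨L', ⟨hL', hne⟩, rfl⟩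
        have hL' : L' ∈ through B p := by
          rcases hL' with rfl | h
          exacts [hHp, h.1]
        exact (eq_of_le_of_finrank_one hp1 (finrank_inf_of_ne (hB2 L hL.1.1) (hB2 L' hL'.1)
          (Ne.symm hne)) (le_inf hL.1.2 hL'.2)).symm
      exact (Set.ncard_le_ncard this).trans (Set.ncard_singleton p).le)
    (killVec_le_logVec H (m - 1))
  -- By modularity every point of a line off `p` is cut out by a line through `p`, so `r = m`; the
  -- conditions are again at most `m, m - 1, …`.
  have h2 := finrank_le_add_sum (A := through B p) (T := B \ through B p) (k := m - 1) (r := m)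
    hfin (fun L hL => hB2 L hL.1) (hB.sdiff (t := through B p)) (fun L hL => hB2 L hL.1)
    Set.disjoint_sdiff_right (fun L hL => by
      have : traces ((through B p ∪ B \ through B p) \ {L}) L ⊆ traces (through B p) L := by
        rintro _ ⟨L', ⟨hL', hne⟩, rfl⟩
        rcases hL' with hL' | hL'
        · exact ⟨L', hL', rfl⟩
        · obtain ⟨N, ⟨hN, hle⟩, -⟩ := hmod L hL L' hL' (Ne.symm hne)
          exact ⟨N, hN, (inf_eq_inf_of_le (hB2 L hL.1) (hB2 L' hL'.1) (hB2 N hN.1) (Ne.symm hne)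
            (fun h => hL.2 (h ▸ hN)) hle).symm⟩
      exact (Set.ncard_le_ncard this (finite_traces hfin L)).trans (traces_ncard_le hfin L))
    (M := killVec H (m - 1) ⊓ logVec (through B p \ {H}) (m - 1)) (by
      have e : through B p = insert H (through B p \ {H}) :=
        (Set.insert_sdiff_self_of_mem hHp).symm
      rw [congrArg (fun C => logVec C (m - 1)) e, logVec_insert, inf_comm]
      exact inf_le_inf_left _ (killVec_le_logVec H (m - 1)))
  have h3 : killVec H (m - 1) ⊓ logVec (through B p \ {H}) (m - 1) ⊓
      logVec (B \ through B p) (m - 1) ≤ logVec B (m - 1) ⊓ killVec H (m - 1) := by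
    rintro P ⟨⟨hP1, hP2⟩, hP3⟩
    refine ⟨⟨hP1.1, fun L hL => ?_⟩, hP1⟩
    by_cases hLp : L ∈ through B p
    · by_cases hLH : L = H
      · exact (killVec_le_logVec H (m - 1) hP1).2 L hLH
      · exact hP2.2 L ⟨hLp, hLH⟩
    · exact hP3.2 L ⟨hL, hLp⟩
  rw [hbot, le_bot_iff] at h3
  rw [h3, finrank_bot] at h2
  -- The space killing the equation of `H` has dimension at least `m (m + 1)`, while the two
  -- families impose at most `m (m + 1) / 2 - 1` and `m (m + 1) / 2` conditions.
  have h4 := two_mul_le_finrank_killVec (hB2 H hH) (m - 1)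
  rw [two_mul_finrank_homogeneousSubmodule] at h4
  have h5 := Set.ncard_sdiff_singleton_add_one hHp hfin
  rw [Set.ncard_singleton] at h1
  have e1 : ∀ j, m - 1 + 1 + 1 - (1 + j) = m - j := fun j => by omega
  have e2 : ∀ j, m - 1 + 1 + m - (m + j) = m - j := fun j => by omega
  simp only [e1] at h1
  simp only [← hm, e2] at h2
  have s1 := two_mul_sum_range_sub m (through B p \ {H}).ncard
  have s2 := two_mul_sum_range_sub m (B \ through B p).ncard
  rw [← hm] at h5
  rw [show m - (through B p \ {H}).ncard = 1 by omega] at s1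
  rw [show m - 1 + 1 = m by omega, show m - 1 + 2 = m + 1 by omega] at h4
  omega

lemma traces_through_subset {B : Set (Submodule K (Fin 3 → K))} {p L : Submodule K (Fin 3 → K)}
    (hpL : ¬ p ≤ L) : traces (through B p) L ⊆ traces (B \ {L}) L :=
  traces_mono (A := through B p) (B := B \ {L}) (fun _ hM => ⟨hM.1, fun h => hpL (h ▸ hM.2)⟩) L

namespace IsProjectiveLineArrangement

variable {A : Set (Submodule K (Fin 3 → K))}

/-- A line off the modular point has at least `m` points, more than the degree `m - 1` of the field
found by counting. -/
lemma not_noDoubleOn_of_supersolvable [CharZero K] (hA : IsProjectiveLineArrangement A)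
    (h : IsSupersolvable A) :
    ∃ L ∈ A, ¬ NoDoubleOn A L := by
  obtain ⟨p, hp⟩ := h
  have hp1 : Module.finrank K p = 1 := hp.1.2
  obtain ⟨H, hH, hne⟩ := hp.exists_vec hA.finite hA.finrank_eq_two
  obtain ⟨L, hL, hpL⟩ := hA.exists_not_le_of_finrank_one hp1
  refine ⟨L, hL, hA.not_noDoubleOn_of_lt hL (hA.finrank_eq_two H hH.1) hne ?_⟩
  have hfin : (through A p).Finite := hA.finite.subset fun L hL => hL.1
  have h1 := Set.ncard_le_ncard (traces_through_subset (B := A) hpL)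
    (finite_traces (hA.finite.sdiff (t := {L})) L)
  rw [ncard_traces_of_through (fun L hL => hA.finrank_eq_two L hL.1) hp1 (fun L hL => hL.2)
    (hA.finrank_eq_two L hL) hpL] at h1
  have := (Set.ncard_pos hfin).2 ⟨H, hH⟩
  omega

lemma not_noDoubleOn_of_nearlySupersolvable [CharZero K] (hA : IsProjectiveLineArrangement A)
    (h : IsNearlySupersolvable A) :
    ∃ L ∈ A, ¬ NoDoubleOn A L := by
  obtain ⟨hns, B, hB, ⟨p, hp⟩, H, hH, rfl⟩ := h
  have hp1 : Module.finrank K p = 1 := hp.1.2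
  have hA2 := hA.finrank_eq_two
  have hB2 := hB.finrank_eq_two
  by_cases hpH : p ≤ H
  swap
  -- Deleting a line off `p` keeps all lines through `p`, so `p` stays modular.
  · refine absurd ⟨p, ?_, fun L hL L' hL' hne => ?_⟩ hns
    · obtain ⟨M, hM, N, hN, hMN, hpMN⟩ := (mem_points_iff hB2).1 hp.1
      have hpM : p ≤ M := hpMN ▸ inf_le_left
      have hpN : p ≤ N := hpMN ▸ inf_le_right
      exact mem_points_of_two hA2 hp1 ⟨hM, fun h => hpH (h ▸ hpM)⟩
        ⟨hN, fun h => hpH (h ▸ hpN)⟩ hMN hpM hpN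
    · have e : through (B \ {H}) p = through B p := by
        ext M
        exact ⟨fun h => ⟨h.1.1, h.2⟩, fun h => ⟨⟨h.1, fun h' => hpH (h' ▸ h.2)⟩, h.2⟩⟩
      rw [e] at hL hL' ⊢
      exact hp.2 L ⟨hL.1.1, hL.2⟩ L' ⟨hL'.1.1, hL'.2⟩ hne
  -- If some line `L` off `p` keeps its point `L ⊓ H` after the deletion of `H`, it still has one
  -- point for each line of `B` through `p`, and the field tangent to `B` is of too small degree.
  by_cases hex : ∃ L ∈ B, ¬ p ≤ L ∧ ∃ L' ∈ B, L' ≠ L ∧ L' ≠ H ∧ L ⊓ L' = L ⊓ H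
  · obtain ⟨L, hL, hpL, L', hL', hne, hne', heq⟩ := hex
    have hLA : L ∈ B \ {H} := ⟨hL, fun h => hpL (h ▸ hpH)⟩
    obtain ⟨M, hM, hbot⟩ := hp.exists_vec hB.finite hB2
    refine ⟨L, hLA, hA.not_noDoubleOn_of_lt hLA (hB2 M hM.1)
      (d := (through B p).ncard - 1) (fun h => hbot ?_) ?_⟩
    · exact le_bot_iff.1 (h ▸ inf_le_inf_right _ (logVec_mono Set.sdiff_subset _))
    · have h1 : traces (through B p) L ⊆ traces ((B \ {H}) \ {L}) L := by
        rintro _ ⟨N, hN, rfl⟩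
        by_cases hNH : N = H
        · exact ⟨L', ⟨⟨hL', hne'⟩, hne⟩, by rw [hNH]; exact heq⟩
        · exact ⟨N, ⟨⟨hN.1, hNH⟩, fun h => hpL (h ▸ hN.2)⟩, rfl⟩
      have h2 := Set.ncard_le_ncard h1 (finite_traces (hA.finite.sdiff (t := {L})) L)
      rw [ncard_traces_of_through (fun L hL => hB2 L hL.1) hp1 (fun L hL => hL.2)
        (hB2 L hL) hpL] at h2
      have := (Set.ncard_pos (hB.finite.subset fun L hL => hL.1 : (through B p).Finite)).2 ⟨M, hM⟩
      omega
  push Not at hex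
  -- Otherwise no two lines of `A` off `p` meet on `H`, so the line through `p` given by modularity
  -- is never the deleted one.
  have hmod : ∀ L ∈ B \ {H}, ¬ p ≤ L → ∀ L' ∈ B \ {H}, ¬ p ≤ L' → L ≠ L' →
      ∃! M, M ∈ through (B \ {H}) p ∧ L ⊓ L' ≤ M := by
    intro L hL hpL L' hL' hpL' hne
    obtain ⟨M, ⟨hM, hle⟩, huniq⟩ :=
      hp.2 L ⟨hL.1, fun h => hpL h.2⟩ L' ⟨hL'.1, fun h => hpL' h.2⟩ hne
    refine ⟨M, ⟨⟨⟨hM.1, fun h => ?_⟩, hM.2⟩, hle⟩, fun N hN =>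
      huniq N ⟨⟨hN.1.1.1, hN.1.2⟩, hN.2⟩⟩
    obtain rfl : M = H := h
    exact hex L hL.1 hpL L' hL'.1 hne.symm hL'.2 (inf_eq_inf_of_le (hB2 L hL.1) (hB2 L' hL'.1)
      (hB2 M hM.1) hne hL.2 hle)
  by_cases hpt : p ∈ points (B \ {H})
  · exact absurd ⟨p, hpt, fun L hL L' hL' hne => hmod L hL.1 (fun h => hL.2 ⟨hL.1, h⟩) L' hL'.1
      (fun h => hL'.2 ⟨hL'.1, h⟩) hne⟩ hns
  exfalso
  -- Here `p` is no longer a point, so a single line `N` of `A` passes through it, and any two other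
  -- lines would have to meet on `N`. All lines other than `N` would then pass through one point of
  -- `N`, against essentiality.
  obtain ⟨N, hN, hpN⟩ : ∃ N ∈ B \ {H}, p ≤ N := by
    obtain ⟨M, hM, N, hN, hMN, hpMN⟩ := (mem_points_iff hB2).1 hp.1
    by_cases hMH : M = H
    · exact ⟨N, ⟨hN, fun h => hMN (hMH.trans (Eq.symm h))⟩, hpMN ▸ inf_le_right⟩
    · exact ⟨M, ⟨hM, hMH⟩, hpMN ▸ inf_le_left⟩
  have honly : ∀ M ∈ B \ {H}, M ≠ N → ¬ p ≤ M := fun M hM hMN hpM =>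
    hpt (mem_points_of_two hA2 hp1 hM hN hMN hpM hpN)
  obtain ⟨L, hL, hLN⟩ := hA.exists_ne hN
  obtain ⟨L', hL', hle⟩ := hA.exists_not_le_of_finrank_one
    (finrank_inf_of_ne (hA2 L hL) (hA2 N hN) hLN)
  have hL'N : L' ≠ N := by rintro rfl; exact hle inf_le_right
  have hLL' : L ≠ L' := by rintro rfl; exact hle inf_le_left
  obtain ⟨M, ⟨hM, hM'⟩, -⟩ := hmod L hL (honly L hL hLN) L' hL' (honly L' hL' hL'N) hLL'
  obtain rfl : M = N := by
    by_contra hne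
    exact honly M hM.1 hne hM.2
  refine hle ?_
  rw [← inf_eq_inf_of_le (hA2 L hL) (hA2 L' hL') (hA2 M hN) hLL' hLN hM']
  exact inf_le_right

end IsProjectiveLineArrangement

/-! ### Derivations -/

/-- The coefficient vector of a derivation. -/
def coords (θ : Derivation K (MvPolynomial (Fin 3) K) (MvPolynomial (Fin 3) K)) :
    Fin 3 → MvPolynomial (Fin 3) K := fun i => θ (X i)

lemma der_linForm (θ : Derivation K (MvPolynomial (Fin 3) K) (MvPolynomial (Fin 3) K))
    (a : Fin 3 → K) : θ (linForm a) = dot a (coords θ) := by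
  simp only [linForm, dot, coords, map_sum, ← MvPolynomial.smul_eq_C_mul,
    Derivation.map_smul]

lemma coords_injective : Function.Injective (coords (K := K)) := fun _ _ h =>
  MvPolynomial.derivation_ext fun i => congrFun h i

lemma coords_mkDerivation (P : Fin 3 → MvPolynomial (Fin 3) K) :
    coords (mkDerivation K P) = P := by
  funext i
  simp [coords]

lemma coords_mem_logVec {A : Set (Submodule K (Fin 3 → K))}
    {θ : Derivation K (MvPolynomial (Fin 3) K) (MvPolynomial (Fin 3) K)} {d : ℕ} :
    coords θ ∈ logVec A d ↔ IsHomogeneousDer θ d ∧ θ ∈ logDer A := by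
  rw [mem_logVec, mem_homVec]
  refine and_congr Iff.rfl ?_
  simp only [← der_linForm]
  rfl

lemma coords_mem_killVec {H : Submodule K (Fin 3 → K)}
    {θ : Derivation K (MvPolynomial (Fin 3) K) (MvPolynomial (Fin 3) K)} {d : ℕ} :
    coords θ ∈ killVec H d ↔ IsHomogeneousDer θ d ∧ ∀ a, Defines a H → θ (linForm a) = 0 := by
  rw [mem_killVec, mem_homVec]
  simp only [← der_linForm]
  rfl

lemma exists_logDerAt_iff {A : Set (Submodule K (Fin 3 → K))} {H : Submodule K (Fin 3 → K)}
    {d : ℕ} : (∃ θ ∈ logDerAt A H, θ ≠ 0 ∧ IsHomogeneousDer θ d) ↔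
      logVec A d ⊓ killVec H d ≠ ⊥ := by
  rw [Submodule.ne_bot_iff]
  constructor
  · rintro ⟨θ, hθ, h0, hd⟩
    exact ⟨coords θ, ⟨coords_mem_logVec.2 ⟨hd, hθ.1⟩, coords_mem_killVec.2 ⟨hd, hθ.2⟩⟩,
      fun h => h0 (coords_injective (h.trans (by funext i; simp [coords])))⟩
  · rintro ⟨P, ⟨h1, h2⟩, h0⟩
    rw [← coords_mkDerivation P] at h1 h2
    rw [SetLike.mem_coe, coords_mem_logVec] at h1
    rw [SetLike.mem_coe, coords_mem_killVec] at h2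
    refine ⟨mkDerivation K P, ⟨h1.2, h2.2⟩, fun h => h0 ?_, h1.1⟩
    rw [← coords_mkDerivation P, h]
    funext i
    simp [coords]

namespace IsProjectiveLineArrangement

variable {A : Set (Submodule K (Fin 3 → K))}

lemma not_noDoubleOn_of_mdr_lt [CharZero K] (hA : IsProjectiveLineArrangement A)
    {H : Submodule K (Fin 3 → K)} (hH : H ∈ A) (h : mdr A < (restriction A H).ncard) :
    ¬ NoDoubleOn A H := by
  -- Without nonemptiness `sInf` would take the default value `0`. In degree `n = |A|` the space
  -- killing the equation of `H` has dimension at least `(n + 1)(n + 2)`, and `n` lines impose at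
  -- most `n (n + 1)` conditions.
  have hne : {d | ∃ H ∈ A, ∃ θ ∈ logDerAt A H, θ ≠ 0 ∧ IsHomogeneousDer θ d}.Nonempty := by
    refine ⟨A.ncard, H, hH, exists_logDerAt_iff.2 fun hbot => ?_⟩
    have h1 := finrank_le_add_mul hA.finite hA.finrank_eq_two (k := A.ncard)
      (M := killVec H A.ncard) fun P hP => hP.1
    rw [inf_comm, hbot, finrank_bot] at h1
    have h2 := two_mul_le_finrank_killVec (hA.finrank_eq_two H hH) A.ncard
    rw [two_mul_finrank_homogeneousSubmodule] at h2
    nlinarith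
  obtain ⟨L, hL, hex⟩ := Nat.sInf_mem hne
  rw [restriction_eq_traces] at h
  exact hA.not_noDoubleOn_of_lt hH (hA.finrank_eq_two L hL) (exists_logDerAt_iff.1 hex) h

end IsProjectiveLineArrangement

/-! ### Free arrangements -/

/-- Multiples `c • P` with `c ∈ S_k`. -/
def multiples (P : Fin 3 → MvPolynomial (Fin 3) K) (k : ℕ) :
    Submodule K (Fin 3 → MvPolynomial (Fin 3) K) :=
  (homogeneousSubmodule (Fin 3) K k).map
    ((LinearMap.toSpanSingleton (MvPolynomial (Fin 3) K) _ P).restrictScalars K)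

lemma smul_mem_multiples (P : Fin 3 → MvPolynomial (Fin 3) K) {k : ℕ}
    {c : MvPolynomial (Fin 3) K} (hc : c.IsHomogeneous k) : c • P ∈ multiples P k :=
  ⟨c, hc, rfl⟩

instance finite_multiples (P : Fin 3 → MvPolynomial (Fin 3) K) (k : ℕ) :
    Module.Finite K (multiples P k) := by
  unfold multiples
  infer_instance

lemma finrank_multiples_le (P : Fin 3 → MvPolynomial (Fin 3) K) (k : ℕ) :
    Module.finrank K (multiples P k) ≤ Module.finrank K (homogeneousSubmodule (Fin 3) K k) :=
  Submodule.finrank_map_le _ _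

lemma coords_euler : coords (euler K) = X := coords_mkDerivation _

lemma IsFreeWith.finrank_logVec_le {A : Set (Submodule K (Fin 3 → K))} {d₂ d₃ : ℕ}
    (h : IsFreeWith A d₂ d₃) {k : ℕ} (h1 : 1 ≤ k) (h2 : d₂ ≤ k) (h3 : d₃ ≤ k) :
    Module.finrank K (logVec A k) ≤ Module.finrank K (homogeneousSubmodule (Fin 3) K (k - 1)) +
      Module.finrank K (homogeneousSubmodule (Fin 3) K (k - d₂)) +
      Module.finrank K (homogeneousSubmodule (Fin 3) K (k - d₃)) := by
  obtain ⟨θ₂, -, θ₃, -, hd₂, hd₃, -, hspan⟩ := h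
  have hle : logVec A k ≤ multiples X (k - 1) ⊔ multiples (coords θ₂) (k - d₂) ⊔
      multiples (coords θ₃) (k - d₃) := by
    intro P hP
    have hP' := hP
    rw [← coords_mkDerivation P, coords_mem_logVec, ← hspan, Submodule.mem_span_triple] at hP
    obtain ⟨-, a, b, c, habc⟩ := hP
    have key : P = homogeneousComponent (k - 1) a • X +
        homogeneousComponent (k - d₂) b • coords θ₂ +
        homogeneousComponent (k - d₃) c • coords θ₃ := by
      funext i
      have e : P i = a * X i + b * θ₂ (X i) + c * θ₃ (X i) := by
        have := congrArg (fun θ => coords θ i) habc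
        simp only [coords, euler, Derivation.add_apply, Derivation.smul_apply, smul_eq_mul,
          mkDerivation_X] at this
        exact this.symm
      have e2 := homogeneousComponent_eq_self (mem_homVec.1 hP'.1 i)
      rw [e, map_add, map_add, homogeneousComponent_mul_right (isHomogeneous_X K i) h1,
        homogeneousComponent_mul_right (hd₂ i) h2, homogeneousComponent_mul_right (hd₃ i) h3,
        ← e] at e2
      rw [← e2]
      rfl
    rw [key]
    exact add_mem (Submodule.mem_sup_left (add_mem
      (Submodule.mem_sup_left (smul_mem_multiples _ (homogeneousComponent_isHomogeneous _ _)))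
      (Submodule.mem_sup_right (smul_mem_multiples _ (homogeneousComponent_isHomogeneous _ _)))))
      (Submodule.mem_sup_right (smul_mem_multiples _ (homogeneousComponent_isHomogeneous _ _)))
  have l1 := Submodule.finrank_mono hle
  have l2 := Submodule.finrank_add_le_finrank_add_finrank
    (multiples (X : Fin 3 → MvPolynomial (Fin 3) K) (k - 1) ⊔ multiples (coords θ₂) (k - d₂))
    (multiples (coords θ₃) (k - d₃))
  have l3 := Submodule.finrank_add_le_finrank_add_finrank
    (multiples (X : Fin 3 → MvPolynomial (Fin 3) K) (k - 1)) (multiples (coords θ₂) (k - d₂))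
  have m1 := finrank_multiples_le (X : Fin 3 → MvPolynomial (Fin 3) K) (k - 1)
  have m2 := finrank_multiples_le (coords θ₂) (k - d₂)
  have m3 := finrank_multiples_le (coords θ₃) (k - d₃)
  omega

/-- The exponents of a free arrangement have sum at most `|A|`. -/
lemma IsFreeWith.add_lt [Infinite K] {A : Set (Submodule K (Fin 3 → K))} (hA : A.Finite)
    (hA2 : ∀ L ∈ A, Module.finrank K L = 2) {d₂ d₃ : ℕ} (h : IsFreeWith A d₂ d₃) :
    d₂ + d₃ < A.ncard := by
  by_contra! hcon
  -- In the dimension count in degree `k`, assuming `|A| ≤ d₂ + d₃`, the terms `k (d₂ + d₃)` cancel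
  -- and leave `2 k + 2 + d₂ + d₃ ≤ d₂² + d₃²`, which fails for this `k`.
  set k := d₂ ^ 2 + d₃ ^ 2 + d₂ + d₃ + 1 with hk
  obtain ⟨x, hx⟩ : ∃ x, k = d₂ + x := ⟨d₂ ^ 2 + d₃ ^ 2 + d₃ + 1, by rw [hk]; ring⟩
  obtain ⟨y, hy⟩ : ∃ y, k = d₃ + y := ⟨d₂ ^ 2 + d₃ ^ 2 + d₂ + 1, by rw [hk]; ring⟩
  have h1 := h.finrank_logVec_le (k := k) (by omega) (by omega) (by omega)
  have h2 := finrank_le_add_mul hA hA2 (k := k) (M := homVec K k) le_rfl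
  rw [finrank_homVec, inf_eq_right.2 (logVec_le_homVec A k)] at h2
  have s0 := two_mul_finrank_homogeneousSubmodule (K := K) k
  have s1 := two_mul_finrank_homogeneousSubmodule (K := K) (k - 1)
  have s2 := two_mul_finrank_homogeneousSubmodule (K := K) (k - d₂)
  have s3 := two_mul_finrank_homogeneousSubmodule (K := K) (k - d₃)
  rw [show k - 1 + 1 = k by omega, show k - 1 + 2 = k + 1 by omega] at s1
  rw [show k - d₂ = x by omega] at s2 h1
  rw [show k - d₃ = y by omega] at s3 h1
  have h3 : A.ncard * (k + 1) ≤ (d₂ + d₃) * (k + 1) := Nat.mul_le_mul_right _ hcon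
  have h4 : 3 * ((k + 1) * (k + 2)) ≤ k * (k + 1) + (x + 1) * (x + 2) + (y + 1) * (y + 2) +
      2 * ((d₂ + d₃) * (k + 1)) := by omega
  zify at h4 hx hy hk
  have hx' : (x : ℤ) = k - d₂ := by linarith
  have hy' : (y : ℤ) = k - d₃ := by linarith
  rw [hx', hy'] at h4
  nlinarith

/-- The product of the equations of `A` times the constant field `e` is tangent to `A`, and its
value at `a` is that product, which does not vanish on `H`. -/
lemma Chart.exists_not_dvd {A : Set (Submodule K (Fin 3 → K))} {H : Submodule K (Fin 3 → K)}
    (c : Chart A H) : ∃ θ ∈ logDer A, ¬ linForm c.a ∣ θ (linForm c.a) := by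
  set f := ∏ b ∈ c.eqns, linForm b with hf
  have hdot : ∀ b, dot b (f • fun i => C (c.frame.e i)) = f * C (b ⬝ᵥ c.frame.e) := fun b => by
    rw [dot_smul_right]
    simp [dot, dotProduct]
  refine ⟨mkDerivation K (f • fun i => C (c.frame.e i)), fun L hL b hb => ?_, fun h => ?_⟩
  · rw [der_linForm, coords_mkDerivation, hdot]
    obtain ⟨r, rfl⟩ := (c.eqn_defines L hL).exists_smul (c.eqn_ne_zero hL) hb
    have h1 : linForm (c.eqn L) ∣ f := Finset.dvd_prod_of_mem _ (c.mem_eqns.2 ⟨L, hL, rfl⟩)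
    have h2 : (r • c.eqn L) ⬝ᵥ c.frame.e = r * (c.eqn L ⬝ᵥ c.frame.e) := by
      rw [smul_dotProduct, smul_eq_mul]
    rw [linForm_smul, h2, map_mul, mul_left_comm]
    exact mul_dvd_mul_left _ (h1.mul_right _)
  · rw [der_linForm, coords_mkDerivation, hdot, c.frame.ae, map_one, mul_one] at h
    have h1 := c.frame.ev_eq_zero_of_dvd h
    rw [hf, map_prod, Finset.prod_eq_zero_iff] at h1
    obtain ⟨b, hb, h0⟩ := h1
    rw [ev_linForm, c.eqns_w b hb] at h0
    have := congrArg (fun p => Polynomial.coeff p 1) h0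
    simp at this

lemma IsFreeWith.symm {A : Set (Submodule K (Fin 3 → K))} {d₂ d₃ : ℕ} (h : IsFreeWith A d₂ d₃) :
    IsFreeWith A d₃ d₂ := by
  obtain ⟨θ₂, h₂, θ₃, h₃, hd₂, hd₃, hli, hspan⟩ := h
  refine ⟨θ₃, h₃, θ₂, h₂, hd₃, hd₂, ?_, ?_⟩
  · have := hli.comp (Equiv.swap (1 : Fin 3) 2) (Equiv.injective _)
    convert this using 1
    funext i
    fin_cases i <;> rfl
  · rw [← hspan]
    congr 1
    ext
    simp [or_comm]

namespace IsProjectiveLineArrangement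

variable {A : Set (Submodule K (Fin 3 → K))}

/-- A line whose deletion is free contains a double point. -/
lemma not_noDoubleOn_of_free_deletion [CharZero K] (hA : IsProjectiveLineArrangement A)
    {H : Submodule K (Fin 3 → K)} (hH : H ∈ A) (h : IsFree (A \ {H})) : ¬ NoDoubleOn A H := by
  intro hd
  obtain ⟨d₂, d₃, h⟩ := h
  obtain ⟨c⟩ := hA.chart hH
  have hsum := h.add_lt (hA.finite.sdiff (t := {H})) fun L hL => hA.finrank_eq_two L hL.1
  have h2 := c.two_mul_le hd
  set n := (A \ {H}).ncard
  set r := (traces (A \ {H}) H).ncard with hr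
  wlog hle : d₂ ≤ d₃ generalizing d₂ d₃
  · exact this d₃ d₂ h.symm (by omega) (by omega)
  -- Then both degrees are below `n - r`, so every field tangent to the deletion is tangent to `H`,
  -- contradicting `Chart.exists_not_dvd`.
  by_cases hd3 : d₃ + r < n
  · obtain ⟨θ, hθ, hnot⟩ := c.exists_not_dvd
    obtain ⟨θ₂, h₂, θ₃, h₃, hd₂, hd₃, hli, hspan⟩ := h
    rw [← hspan, Submodule.mem_span_triple] at hθ
    obtain ⟨x, y, z, rfl⟩ := hθ
    have t2 := (logVec_le_of_lt c (k := d₂) (by omega) (coords_mem_logVec.2 ⟨hd₂, h₂⟩)).2 H rfl _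
      c.defines
    have t3 := (logVec_le_of_lt c (k := d₃) (by omega) (coords_mem_logVec.2 ⟨hd₃, h₃⟩)).2 H rfl _
      c.defines
    rw [← der_linForm] at t2 t3
    refine hnot ?_
    simp only [Derivation.add_apply, Derivation.smul_apply, smul_eq_mul]
    refine dvd_add (dvd_add (Dvd.dvd.mul_left ?_ _) (t2.mul_left _)) (t3.mul_left _)
    rw [der_linForm, coords_euler, dot_X]
  -- Now `d₂ < n - d₃ ≤ r ≤ n - r`, so `θ₂` is tangent to `H` as well and has degree below `r`.
  -- Independence from the Euler field lets it be moved to a nonzero element of `D_H(A)`.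
  · obtain ⟨θ₂, h₂, θ₃, h₃, hd₂, hd₃, hli, hspan⟩ := h
    have m2 := coords_mem_logVec.2 ⟨hd₂, h₂⟩
    have t2 := logVec_le_of_lt c (k := d₂) (by omega) m2
    have t3 : coords θ₂ ∈ logVec A d₂ := by
      rw [← Set.insert_sdiff_self_of_mem hH, logVec_insert]
      exact ⟨m2, t2⟩
    refine exists_mem_killVec (hA.finrank_eq_two H hH) hH t3 (fun g hg => ?_)
      (hA.eq_bot_of_lt hH hd (by omega))
    have hθ : θ₂ = g • euler K := coords_injective (by
      rw [hg, ← coords_euler]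
      rfl)
    have := Fintype.linearIndependent_iff.1 hli ![g, -1, 0] (by
      simp [Fin.sum_univ_three, hθ]) 1
    simp at this

end IsProjectiveLineArrangement

/-! ### The sum of the Möbius numbers -/

/-- The sum of `μ(q)` over all points `q`. -/
def sumMu (A : Set (Submodule K (Fin 3 → K))) : ℤ := ∑ᶠ q ∈ points A, mu A q

lemma points_mono {A B : Set (Submodule K (Fin 3 → K))} (h : A ⊆ B) : points A ⊆ points B :=
  fun _ ⟨⟨C, hC, hX⟩, h1⟩ => ⟨⟨C, hC.trans h, hX⟩, h1⟩

lemma mem_traces_iff {A : Set (Submodule K (Fin 3 → K))} (hA2 : ∀ L ∈ A, Module.finrank K L = 2)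
    {H : Submodule K (Fin 3 → K)} (hH : Module.finrank K H = 2) (hHA : H ∉ A)
    {q : Submodule K (Fin 3 → K)} : q ∈ traces A H ↔ q ∈ points (insert H A) ∧ q ≤ H := by
  have hI2 : ∀ L ∈ insert H A, Module.finrank K L = 2 := by
    rintro L (rfl | h)
    exacts [hH, hA2 L h]
  constructor
  · rintro ⟨L, hL, rfl⟩
    exact ⟨(mem_points_iff hI2).2 ⟨H, Set.mem_insert H A, L, Set.mem_insert_of_mem H hL,
      fun h => hHA (h ▸ hL), rfl⟩, inf_le_left⟩
  · rintro ⟨hq, hqH⟩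
    obtain ⟨L, hL, hqL⟩ : ∃ L ∈ A, q ≤ L := by
      obtain ⟨M, hM, N, hN, hMN, rfl⟩ := (mem_points_iff hI2).1 hq
      rcases hM with rfl | hM
      · exact ⟨N, hN.resolve_left hMN.symm, inf_le_right⟩
      · exact ⟨M, hM, inf_le_left⟩
    exact ⟨L, hL, (eq_of_le_of_finrank_one hq.2 (finrank_inf_of_ne hH (hA2 L hL)
      fun h => hHA (h ▸ hL)) (le_inf hqH hqL)).symm⟩

lemma mu_insert {A : Set (Submodule K (Fin 3 → K))} (hA : A.Finite)
    {H : Submodule K (Fin 3 → K)} (hHA : H ∉ A) (q : Submodule K (Fin 3 → K)) [Decidable (q ≤ H)] :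
    mu (insert H A) q = mu A q + if q ≤ H then 1 else 0 := by
  split_ifs with h
  · have : through (insert H A) q = insert H (through A q) := by
      ext L
      simp only [through, Set.mem_ofPred_eq, Set.mem_insert_iff]
      constructor
      · rintro ⟨rfl | h1, h2⟩
        exacts [Or.inl rfl, Or.inr ⟨h1, h2⟩]
      · rintro (rfl | ⟨h1, h2⟩)
        exacts [⟨Or.inl rfl, h⟩, ⟨Or.inr h1, h2⟩]
    rw [mu, mu, this, Set.ncard_insert_of_notMem (fun h => hHA h.1)
      (hA.subset fun L hL => hL.1)]
    push_cast
    ring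
  · have : through (insert H A) q = through A q := by
      ext L
      simp only [through, Set.mem_ofPred_eq, Set.mem_insert_iff]
      constructor
      · rintro ⟨rfl | h1, h2⟩
        exacts [absurd h2 h, ⟨h1, h2⟩]
      · exact fun h => ⟨Or.inr h.1, h.2⟩
    rw [mu, mu, this, add_zero]

/-- Adding `H` raises `μ` by one at every point of `H`. A new point lies on exactly one line of `A`,
so it had `μ = 0` and may be included in the sum beforehand. -/
lemma sumMu_insert {A : Set (Submodule K (Fin 3 → K))} (hA : A.Finite)
    (hA2 : ∀ L ∈ A, Module.finrank K L = 2) {H : Submodule K (Fin 3 → K)}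
    (hH : Module.finrank K H = 2) (hHA : H ∉ A) :
    sumMu (insert H A) = sumMu A + (traces A H).ncard := by
  classical
  have hI2 : ∀ L ∈ insert H A, Module.finrank K L = 2 := by
    rintro L (rfl | h)
    exacts [hH, hA2 L h]
  have hf := finite_points (hA.insert H) hI2
  have hfA := finite_points hA hA2
  have hsub : hfA.toFinset ⊆ hf.toFinset := by
    simpa using points_mono (Set.subset_insert H A)
  have h1 : sumMu A = ∑ q ∈ hf.toFinset, mu A q := by
    rw [sumMu, finsum_mem_eq_finite_toFinset_sum _ hfA]
    refine Finset.sum_subset hsub fun q hq hqA => ?_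
    rw [Set.Finite.mem_toFinset] at hq hqA
    obtain ⟨L, hL, hqL⟩ : ∃ L ∈ A, q ≤ L := by
      obtain ⟨M, hM, N, hN, hMN, rfl⟩ := (mem_points_iff hI2).1 hq
      rcases hM with rfl | hM
      · exact ⟨N, hN.resolve_left hMN.symm, inf_le_right⟩
      · exact ⟨M, hM, inf_le_left⟩
    have : through A q = {L} := by
      ext L'
      constructor
      · rintro ⟨hL', hqL'⟩
        by_contra hne
        exact hqA (mem_points_of_two hA2 hq.2 hL' hL hne hqL' hqL)
      · rintro rfl
        exact ⟨hL, hqL⟩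
    rw [mu, this, Set.ncard_singleton]
    norm_num
  have h2 : (traces A H).ncard = (hf.toFinset.filter fun q => q ≤ H).card := by
    rw [← Set.ncard_coe_finset]
    congr 1
    ext q
    rw [mem_traces_iff hA2 hH hHA]
    simp
  rw [sumMu, finsum_mem_eq_finite_toFinset_sum _ hf, h1, h2, Finset.card_filter]
  push_cast
  rw [← Finset.sum_add_distrib]
  exact Finset.sum_congr rfl fun q _ => mu_insert hA hHA q

lemma sumMu_of_subsingleton {A : Set (Submodule K (Fin 3 → K))}
    (hA2 : ∀ L ∈ A, Module.finrank K L = 2) (h : A.Subsingleton) : sumMu A = 0 := by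
  have : points A = ∅ := by
    rw [Set.eq_empty_iff_forall_notMem]
    intro q hq
    obtain ⟨M, hM, N, hN, hMN, -⟩ := (mem_points_iff hA2).1 hq
    exact hMN (h hM hN)
  simp [sumMu, this]

/-- Lower bound for the dimension of `D_H(A ∪ {H})_k` in terms of the Möbius numbers. -/
lemma le_two_mul_finrank [Infinite K] {A : Set (Submodule K (Fin 3 → K))} (hA : A.Finite)
    (hA2 : ∀ L ∈ A, Module.finrank K L = 2) {H : Submodule K (Fin 3 → K)}
    (hH : Module.finrank K H = 2) (hHA : H ∉ A) {k : ℕ} (hk : A.ncard ≤ k) :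
    2 * ((k : ℤ) + 1) * (k + 2) + A.ncard * (A.ncard + 1) ≤
      2 * Module.finrank K (logVec A k ⊓ killVec H k : Submodule K _) +
        2 * A.ncard * (k + 1) + 2 * sumMu (insert H A) := by
  induction A, hA using Set.Finite.induction_on with
  | empty =>
    have h1 := two_mul_le_finrank_killVec hH k
    have h2 := two_mul_finrank_homogeneousSubmodule (K := K) k
    have h3 : logVec ∅ k ⊓ killVec H k = killVec H k := by
      rw [logVec_empty]
      exact inf_eq_right.2 fun P hP => hP.1
    rw [h3, sumMu_of_subsingleton (by rintro _ (rfl | h); exacts [hH, hA2 _ h]) (by simp)]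
    simp only [Set.ncard_empty]
    push_cast
    zify at h1 h2
    linarith
  | @insert L A hLA hA ih =>
    have hA2' : ∀ L ∈ A, Module.finrank K L = 2 := fun L hL => hA2 L (Set.mem_insert_of_mem _ hL)
    have hHA' : H ∉ A := fun h => hHA (Set.mem_insert_of_mem _ h)
    have hLH : L ∉ insert H A := by
      rintro (rfl | h)
      exacts [hHA (Set.mem_insert _ _), hLA h]
    have hL2 := hA2 L (Set.mem_insert L A)
    have hI2 : ∀ L ∈ insert H A, Module.finrank K L = 2 := by
      rintro L (rfl | h)
      exacts [hH, hA2' L h]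
    rw [Set.ncard_insert_of_notMem hLA hA] at hk ⊢
    have h1 := ih hA2' hHA' (by omega)
    have h2 := finrank_le_add_of_le_logVec (hA.insert H) hI2 hL2 hLH (k := k)
      (M := logVec A k ⊓ killVec H k) (by
        rw [logVec_insert]
        exact inf_le_inf_left _ (killVec_le_logVec H k))
    rw [Set.ncard_insert_of_notMem hHA' hA, inf_right_comm, ← logVec_insert] at h2
    have h3 := sumMu_insert (hA.insert H) hI2 hL2 hLH
    rw [Set.insert_comm, h3]
    -- The assumption `|A| ≤ k` keeps the subtraction from truncating. The number of points on `L`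
    -- is also the growth of `sumMu`, so it is absorbed there.
    rw [show k + 1 + (traces (insert H A) L).ncard - (A.ncard + 1) =
      k - A.ncard + (traces (insert H A) L).ncard by omega] at h2
    zify [(by omega : A.ncard ≤ k)] at h2
    push_cast
    linarith

/-! ### Binary vector fields with prescribed tangency -/

/-- The vector fields `f u + g w` with `f`, `g` of degree less than `j`, tangent of order `m q` at the
points with parameter `q ∈ T`. -/
def tangentFields (T : Finset K) (m : K → ℕ) (j : ℕ) :
    Submodule K (Polynomial K × Polynomial K) where
  carrier := {x | x ∈ (Polynomial.degreeLT K j).prod (Polynomial.degreeLT K j) ∧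
    ∀ q ∈ T, (Polynomial.X - Polynomial.C q) ^ m q ∣ x.2 - Polynomial.C q * x.1}
  add_mem' hx hy := ⟨add_mem hx.1 hy.1, fun q hq => by
    have := dvd_add (hx.2 q hq) (hy.2 q hq)
    convert this using 1
    simp only [Prod.fst_add, Prod.snd_add]
    ring⟩
  zero_mem' := ⟨zero_mem _, fun q _ => by simp⟩
  smul_mem' c x hx := ⟨Submodule.smul_mem _ c hx.1, fun q hq => by
    have := (hx.2 q hq).mul_left (Polynomial.C c)
    convert this using 1
    simp only [Prod.smul_fst, Prod.smul_snd, Polynomial.smul_eq_C_mul]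
    ring⟩

instance finite_tangentFields (T : Finset K) (m : K → ℕ) (j : ℕ) :
    Module.Finite K (tangentFields T m j) := by
  have : Module.Finite K ((Polynomial.degreeLT K j).prod (Polynomial.degreeLT K j)) :=
    Module.Finite.iff_fg.2 ((Module.Finite.iff_fg.1 inferInstance).prod
      (Module.Finite.iff_fg.1 inferInstance))
  exact Submodule.finiteDimensional_of_le (S₂ := (Polynomial.degreeLT K j).prod
    (Polynomial.degreeLT K j)) fun x hx => hx.1

lemma mem_degreeLT_succ_iff {f : Polynomial K} {j : ℕ} :
    f ∈ Polynomial.degreeLT K (j + 1) ↔ f.natDegree ≤ j := by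
  rw [Polynomial.mem_degreeLT, Polynomial.degree_lt_iff_coeff_zero,
    Polynomial.natDegree_le_iff_coeff_eq_zero]
  rfl

lemma mem_degreeLT_of_coeff_eq_zero {f : Polynomial K} {j : ℕ}
    (hf : f ∈ Polynomial.degreeLT K (j + 1)) (h : f.coeff j = 0) :
    f ∈ Polynomial.degreeLT K j := by
  rw [Polynomial.mem_degreeLT, Polynomial.degree_lt_iff_coeff_zero] at hf ⊢
  intro i hi
  rcases Nat.eq_or_lt_of_le hi with rfl | h'
  · exact h
  · exact hf i h'

/-- The pair of coefficients of degree `j`. -/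
def leadPair (K : Type u) [Field K] (j : ℕ) : (Polynomial K × Polynomial K) →ₗ[K] K × K :=
  (Polynomial.lcoeff K j).prodMap (Polynomial.lcoeff K j)

lemma leadPair_apply (j : ℕ) (x : Polynomial K × Polynomial K) :
    leadPair K j x = (x.1.coeff j, x.2.coeff j) := rfl

section TangentFields

variable {T : Finset K} {m : K → ℕ}

lemma tangentFields_mono {i j : ℕ} (h : i ≤ j) : tangentFields T m i ≤ tangentFields T m j :=
  fun _ hx => ⟨⟨Polynomial.degreeLT_mono h hx.1.1, Polynomial.degreeLT_mono h hx.1.2⟩, hx.2⟩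

lemma mem_tangentFields_of_leadPair_eq_zero {j : ℕ} {x : Polynomial K × Polynomial K}
    (hx : x ∈ tangentFields T m (j + 1)) (h : leadPair K j x = 0) : x ∈ tangentFields T m j := by
  rw [leadPair_apply, Prod.mk_eq_zero] at h
  exact ⟨⟨mem_degreeLT_of_coeff_eq_zero hx.1.1 h.1, mem_degreeLT_of_coeff_eq_zero hx.1.2 h.2⟩,
    hx.2⟩

lemma finrank_tangentFields_succ_le (j : ℕ) (R : Submodule K (K × K))
    (hR : ∀ x ∈ tangentFields T m (j + 1), leadPair K j x ∈ R) :
    Module.finrank K (tangentFields T m (j + 1)) ≤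
      Module.finrank K (tangentFields T m j) + Module.finrank K R :=
  finrank_le_of_ker_le (leadPair K j) _ _ _ hR fun _ hx h =>
    mem_tangentFields_of_leadPair_eq_zero hx h

lemma tangentFields_zero : tangentFields T m 0 = ⊥ := by
  rw [eq_bot_iff]
  rintro ⟨f, g⟩ ⟨⟨h1, h2⟩, -⟩
  rw [SetLike.mem_coe, Polynomial.mem_degreeLT, Polynomial.degree_lt_iff_coeff_zero] at h1 h2
  rw [Submodule.mem_bot, Prod.mk_eq_zero]
  exact ⟨Polynomial.ext fun i => h1 i (Nat.zero_le i),
    Polynomial.ext fun i => h2 i (Nat.zero_le i)⟩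

/-- The determinant of two tangent fields vanishes if the sum of the degrees is less than the total
order of tangency. -/
lemma det_leadPair_eq_zero {i j : ℕ} {x y : Polynomial K × Polynomial K}
    (hx : x ∈ tangentFields T m (i + 1)) (hy : y ∈ tangentFields T m (j + 1))
    (hij : i + j < ∑ q ∈ T, m q) :
    x.1.coeff i * y.2.coeff j - x.2.coeff i * y.1.coeff j = 0 := by
  have hx1 := mem_degreeLT_succ_iff.1 hx.1.1
  have hx2 := mem_degreeLT_succ_iff.1 hx.1.2
  have hy1 := mem_degreeLT_succ_iff.1 hy.1.1
  have hy2 := mem_degreeLT_succ_iff.1 hy.1.2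
  -- At each `q` the two fields are parallel up to order `m q`: the determinant equals `x₁ (y₂ - q
  -- y₁) - y₁ (x₂ - q x₁)`.
  have hdvd : ∏ q ∈ T, (Polynomial.X - Polynomial.C q) ^ m q ∣ x.1 * y.2 - x.2 * y.1 := by
    refine Finset.prod_dvd_of_coprime (isCoprime_pow_X_sub_C m _) fun q hq => ?_
    have := dvd_sub ((hy.2 q hq).mul_left x.1) ((hx.2 q hq).mul_left y.1)
    convert this using 1
    ring
  have h0 : x.1 * y.2 - x.2 * y.1 = 0 := by
    refine Polynomial.eq_zero_of_dvd_of_natDegree_lt hdvd ?_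
    rw [natDegree_prod_pow]
    refine lt_of_le_of_lt (Polynomial.natDegree_sub_le_of_le (m := i + j) (n := i + j) ?_ ?_)
      (by simpa using hij)
    · exact Polynomial.natDegree_mul_le_of_le hx1 hy2
    · exact Polynomial.natDegree_mul_le_of_le hx2 hy1
  have := congrArg (fun p => Polynomial.coeff p (i + j)) h0
  simpa only [Polynomial.coeff_sub, Polynomial.coeff_mul_add_eq_of_natDegree_le hx1 hy2,
    Polynomial.coeff_mul_add_eq_of_natDegree_le hx2 hy1, Polynomial.coeff_zero] using this

/-- If there are no tangent fields of degree less than `h`, the numbers of tangent fields are bounded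
as for exponents `h` and `N - h`, where `N` is the total order of tangency. -/
lemma finrank_tangentFields_le {h : ℕ} (h2 : 2 * h ≤ ∑ q ∈ T, m q)
    (hbot : tangentFields T m h = ⊥) (j : ℕ) :
    Module.finrank K (tangentFields T m j) ≤ (j - h) + (j - (∑ q ∈ T, m q - h)) := by
  classical
  set N := ∑ q ∈ T, m q
  by_cases hall : ∀ i, tangentFields T m (i + 1) = ⊥
  · rcases j with _ | j
    · rw [tangentFields_zero, finrank_bot]; omega
    · rw [hall, finrank_bot]; omega
  push Not at hall
  set x := Nat.find hall with hx
  have hxne : tangentFields T m (x + 1) ≠ ⊥ := Nat.find_spec hall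
  have hlt : ∀ i ≤ x, tangentFields T m i = ⊥ := fun i hi => by
    rcases i with _ | i
    · exact tangentFields_zero
    · by_contra hne
      exact Nat.find_min hall (m := i) (by omega) hne
  have hhx : h ≤ x := by
    by_contra! hcon
    exact hxne (le_bot_iff.1 (hbot ▸ tangentFields_mono (by omega)))
  obtain ⟨y, hy, hy0⟩ := (Submodule.ne_bot_iff _).1 hxne
  have hlead : leadPair K x y ≠ 0 := fun h0 => hy0 (by
    have := mem_tangentFields_of_leadPair_eq_zero hy h0
    rwa [hlt x le_rfl, Submodule.mem_bot] at this)
  -- Below degree `N - x` the leading pair of any tangent field is proportional to that of the field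
  -- `y` of least degree `x`, so the dimension grows by at most one per degree; later by at most
  -- two.
  have hone : ∀ j, x + j < N → Module.finrank K (tangentFields T m (j + 1)) ≤
      Module.finrank K (tangentFields T m j) + 1 := fun j hj => by
    refine (finrank_tangentFields_succ_le j (Submodule.span K {leadPair K x y})
      fun z hz => ?_).trans_eq (congrArg _ (finrank_span_singleton hlead))
    have hdet := det_leadPair_eq_zero hy hz hj
    rw [leadPair_apply] at hlead
    rw [leadPair_apply, leadPair_apply, Submodule.mem_span_singleton]
    by_cases h1 : y.1.coeff x = 0
    · have h2 : y.2.coeff x ≠ 0 := fun h2 => hlead (by rw [h1, h2]; rfl)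
      refine ⟨z.2.coeff j / y.2.coeff x, ?_⟩
      rw [h1, zero_mul, zero_sub, neg_eq_zero] at hdet
      ext
      · simp [h1, (mul_eq_zero.1 hdet).resolve_left h2]
      · simp [h2]
    · refine ⟨z.1.coeff j / y.1.coeff x, ?_⟩
      ext
      · simp [h1]
      · simp only [Prod.smul_mk, smul_eq_mul]
        field_simp
        linear_combination -hdet
  have htwo : ∀ j, Module.finrank K (tangentFields T m (j + 1)) ≤
      Module.finrank K (tangentFields T m j) + 2 := fun j => by
    have := finrank_tangentFields_succ_le (T := T) (m := m) j ⊤ fun _ _ => Submodule.mem_top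
    simpa using this
  -- This is the bound for the true least degree `x ≥ h`. Passing to `h` only spreads the exponents
  -- further apart, which increases the truncated sum.
  have key : Module.finrank K (tangentFields T m j) ≤ (j - x) + (j - max x (N - x)) := by
    induction j with
    | zero => rw [tangentFields_zero, finrank_bot]; omega
    | succ j ih =>
      by_cases hjx : j < x
      · rw [hlt _ (by omega), finrank_bot]; omega
      by_cases hj : x + j < N
      · have := hone j hj
        omega
      · have := htwo j
        omega
  omega

end TangentFields

/-! ### Dimension bounds and divisional freeness -/

/-- Upper bound for the dimension of `D_H(A)_k` if there is no double point on `H`. -/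
lemma Chart.two_mul_finrank_le [CharZero K] {A : Set (Submodule K (Fin 3 → K))}
    {H : Submodule K (Fin 3 → K)} (c : Chart A H)
    (hd : ∀ L ∈ A, ∃ L' ∈ A, L' ≠ L ∧ H ⊓ L' = H ⊓ L) (h2 : 2 ≤ (traces A H).ncard) (k : ℕ) :
    2 * Module.finrank K (logVec A k ⊓ killVec H k : Submodule K _) ≤
      (k + 1 - (traces A H).ncard) * (k + 2 - (traces A H).ncard) +
      (k + 1 - (A.ncard - (traces A H).ncard)) * (k + 2 - (A.ncard - (traces A H).ncard)) := by
  have hfib := c.two_le_fib hd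
  set T := params c.u c.eqns
  set m := fun q => (fib c.u c.eqns q).card
  have hN : ∑ q ∈ T, m q = A.ncard := by rw [sum_card_fib, c.card_eqns]
  have hT : T.card = (traces A H).ncard := c.card_params
  have hle := c.two_mul_le hd
  rw [← hT] at h2 hle ⊢
  have hbot : tangentFields T m T.card = ⊥ := by
    rw [eq_bot_iff]
    rintro ⟨f, g⟩ ⟨⟨hf, hg⟩, hx⟩
    obtain ⟨d, hd⟩ : ∃ d, T.card = d + 1 := ⟨T.card - 1, by omega⟩
    rw [hd] at hf hg
    obtain ⟨rfl, rfl⟩ := eq_zero_of_sq_dvd (mem_degreeLT_succ_iff.1 hf)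
      (mem_degreeLT_succ_iff.1 hg) (by omega) h2 fun q hq =>
        (pow_dvd_pow _ (hfib q hq)).trans (hx q hq)
    rfl
  have hW := fun j => finrank_tangentFields_le (T := T) (m := m) (hN ▸ hle) hbot j
  rw [hN] at hW
  -- Restriction to `H`: its image consists of tangent fields, and its kernel in degree `k` is `α_H`
  -- times the same space in degree `k - 1`. Induction on `k` adds up the bounds for tangent fields.
  let φ : (Fin 3 → MvPolynomial (Fin 3) K) →ₗ[K] Polynomial K × Polynomial K :=
    ((ev c.u c.w).toLinearMap ∘ₗ dotₗ c.frame.s).prod ((ev c.u c.w).toLinearMap ∘ₗ dotₗ c.frame.t)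
  have hφ : ∀ k, ∀ P ∈ logVec A k ⊓ killVec H k, φ P ∈ tangentFields T m (k + 1) :=
    fun k P hP => ⟨⟨mem_degreeLT_succ_iff.2 (natDegree_ev_le _ _
      (dot_homogeneous (mem_homVec.1 hP.1.1))), mem_degreeLT_succ_iff.2 (natDegree_ev_le _ _
      (dot_homogeneous (mem_homVec.1 hP.1.1)))⟩, fun q _ =>
      c.frame.pow_card_fib_dvd c.eqns_w (c.logOn hP.1) (hP.2.2 _ c.defines) q⟩
  have hker : ∀ k, ∀ P ∈ logVec A k ⊓ killVec H k, φ P = 0 → ∀ j, linForm c.a ∣ P j :=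
    fun k P hP h0 j => by
      have h0' := Prod.mk_eq_zero.1 h0
      have hs : ev c.u c.w (dot c.frame.s P) = 0 := h0'.1
      have ht : ev c.u c.w (dot c.frame.t P) = 0 := h0'.2
      rw [← c.frame.ev_eq_zero_iff (mem_homVec.1 hP.1.1 j), c.frame.vec_decomp P j,
        hP.2.2 _ c.defines]
      simp [hs, ht]
  -- The products are twice truncated triangular numbers, with increments matching the bound in each
  -- degree.
  have harith : ∀ p r : ℕ, (p + 1 - r) * (p + 2 - r) = (p - r) * (p + 1 - r) + 2 * (p + 1 - r) :=
    fun p r => by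
      rcases Nat.lt_or_ge p r with h | h
      · rw [Nat.sub_eq_zero_of_le (by omega : p + 1 ≤ r)]; simp
      · obtain ⟨t, rfl⟩ := Nat.exists_eq_add_of_le h
        rw [show r + t - r = t by omega, show r + t + 1 - r = t + 1 by omega,
          show r + t + 2 - r = t + 2 by omega]
        ring
  have hfin : ∀ k, Module.Finite K (logVec A k ⊓ killVec H k : Submodule K _) := fun k =>
    Submodule.finiteDimensional_of_le (S₂ := logVec A k) inf_le_left
  induction k with
  | zero =>
    have h1 := finrank_le_of_ker_le φ (logVec A 0 ⊓ killVec H 0) ⊥ (tangentFields T m 1) (hφ 0)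
      fun P hP h0 => (Submodule.mem_bot K).2 (funext fun j =>
        eq_zero_of_linForm_dvd_of_homogeneous_zero c.frame.a_ne_zero (mem_homVec.1 hP.1.1 j)
          (hker 0 P hP h0 j))
    have h3 := hW 1
    rw [finrank_bot, zero_add] at h1
    have e1 := harith 0 T.card
    have e2 := harith 0 (A.ncard - T.card)
    simp only [Nat.zero_sub, zero_mul, zero_add] at e1 e2 ⊢
    omega
  | succ k ih =>
    have h1 := finrank_le_of_ker_le φ (logVec A (k + 1) ⊓ killVec H (k + 1))
      ((logVec A k ⊓ killVec H k).map
        (LinearMap.lsmul (MvPolynomial (Fin 3) K) (Fin 3 → MvPolynomial (Fin 3) K)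
          (linForm c.a) |>.restrictScalars K))
      (tangentFields T m (k + 1 + 1)) (hφ (k + 1)) fun P hP h0 => by
        choose P' hP' hPP' using fun j => exists_homogeneous_factor (mem_homVec.1 hP.1.1 j)
          (hker (k + 1) P hP h0 j)
        have hPe : P = linForm c.a • P' := funext hPP'
        refine ⟨P', ⟨⟨mem_homVec.2 hP', fun L hL b hb => ?_⟩, mem_homVec.2 hP', fun b hb => ?_⟩,
          hPe.symm⟩
        · refine (c.eqn_defines L hL).dvd_iff (c.eqn_ne_zero hL) hb ?_
          have h3 := hP.1.2 L hL _ (c.eqn_defines L hL)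
          rw [hPe, dot_smul_right] at h3
          exact ((linForm_prime (c.eqn_ne_zero hL)).dvd_or_dvd h3).resolve_left
            (c.frame.not_linForm_dvd (c.eqn_w L hL))
        · have h3 := hP.2.2 b hb
          rw [hPe, dot_smul_right] at h3
          exact (mul_eq_zero.1 h3).resolve_left (linForm_ne_zero c.frame.a_ne_zero)
    have h3 := Submodule.finrank_map_le
      (LinearMap.lsmul (MvPolynomial (Fin 3) K) (Fin 3 → MvPolynomial (Fin 3) K)
        (linForm c.a) |>.restrictScalars K) (logVec A k ⊓ killVec H k)
    have h4 := hW (k + 1 + 1)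
    have e1 := harith (k + 1) T.card
    have e2 := harith (k + 1) (A.ncard - T.card)
    rw [show k + 1 + 1 = k + 2 from rfl] at *
    omega

namespace IsProjectiveLineArrangement

variable {A : Set (Submodule K (Fin 3 → K))}

lemma not_noDoubleOn_of_chi0_eq_zero [CharZero K] (hA : IsProjectiveLineArrangement A)
    {H : Submodule K (Fin 3 → K)} (hH : H ∈ A) (h : chi0 A ((restriction A H).ncard - 1) = 0) :
    ¬ NoDoubleOn A H := by
  intro hd
  obtain ⟨c⟩ := hA.chart hH
  have hfin := hA.finite.sdiff (t := {H})
  have hup := c.two_mul_finrank_le hd (hA.two_le_traces hH) (A \ {H}).ncard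
  have hlow := le_two_mul_finrank hfin (fun L hL => hA.finrank_eq_two L hL.1)
    (hA.finrank_eq_two H hH) (fun h => h.2 rfl) (k := (A \ {H}).ncard) le_rfl
  have hle := c.two_mul_le hd
  have hcard := Set.ncard_sdiff_singleton_add_one hH hA.finite
  rw [Set.insert_sdiff_self_of_mem hH] at hlow
  rw [chi0, restriction_eq_traces, ← hcard] at h
  change _ + sumMu A - _ + 1 = 0 at h
  set N := (A \ {H}).ncard
  set r := (traces (A \ {H}) H).ncard
  set g := Module.finrank K (logVec (A \ {H}) N ⊓ killVec H N : Submodule K _)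
  -- A root `r - 1` of `χ₀` has partner `N - r + 1`, whereas the upper bound belongs to exponents
  -- `r` and `N - r`. The two bounds on `2 g` then miss each other by `2 (N - 2 r + 1) > 0`.
  obtain ⟨s, hs⟩ := Nat.exists_eq_add_of_le hle
  have e1 : N + 1 - r = r + s + 1 := by omega
  have e2 : N + 2 - r = r + s + 2 := by omega
  have e3 : N + 1 - (N - r) = r + 1 := by omega
  have e4 : N + 2 - (N - r) = r + 2 := by omega
  rw [e1, e2, e3, e4] at hup
  rw [hs] at hlow h
  zify at hup
  push_cast at hlow h
  nlinarith

end IsProjectiveLineArrangement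

/-! ### Inductively free arrangements -/

lemma InductivelyFreeWith.numerics {V : Type u} [AddCommGroup V] [Module K V]
    {A : Set (Submodule K V)} {E : Multiset ℕ} (h : InductivelyFreeWith K V A E) :
    A.Finite ∧ E.card = Module.finrank K V ∧ E.sum = A.ncard := by
  induction h with
  | empty V => simp
  | addition V A H b E hH hdel hres ih1 ih2 =>
    obtain ⟨h1, h2, h3⟩ := ih1
    have hA : A.Finite := (h1.insert H).subset fun L hL => by
      by_cases h : L = H
      · exact Or.inl h
      · exact Or.inr ⟨hL, h⟩
    have h4 := Set.ncard_sdiff_singleton_add_one hH hA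
    refine ⟨hA, by simpa using h2, ?_⟩
    rw [Multiset.sum_cons] at h3 ⊢
    omega

/-- A nonempty inductively free arrangement of `n` lines in a vector plane has exponents
`1, n - 1`. -/
lemma InductivelyFreeWith.exponents_of_finrank_two {V : Type u} [AddCommGroup V] [Module K V]
    {A : Set (Submodule K V)} {E : Multiset ℕ} (h : InductivelyFreeWith K V A E)
    (hV : Module.finrank K V = 2) (hA : ∀ L ∈ A, Module.finrank K L = 1) (hne : A.Nonempty) :
    E = {1, A.ncard - 1} := by
  obtain ⟨hfin, -, -⟩ := h.numerics
  cases h with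
  | empty => simp at hne
  | addition V A H b E hH hdel hres =>
    have : FiniteDimensional K V := Module.finite_of_finrank_pos (by omega)
    obtain ⟨-, h2, h3⟩ := hdel.numerics
    obtain ⟨-, -, h5⟩ := hres.numerics
    rw [Multiset.card_cons, hV] at h2
    obtain ⟨c, rfl⟩ := Multiset.card_eq_one.1 (by omega : E.card = 1)
    have h6 := Set.ncard_sdiff_singleton_add_one hH hfin
    rw [Multiset.sum_cons, Multiset.sum_singleton] at h3
    rw [Multiset.sum_singleton] at h5
    -- Distinct lines of a vector plane meet only in the origin, so the restriction has at most one
    -- member and the exponent `c` is `0` or `1`.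
    have hsub : restrictionIn A H ⊆ {⊥} := by
      rintro _ ⟨L, hL, hne, rfl⟩
      rw [Set.mem_singleton_iff]
      refine Submodule.map_injective_of_injective H.injective_subtype ?_
      rw [Submodule.map_bot, Submodule.map_comap_subtype]
      by_contra hbot
      have h7 : 0 < Module.finrank K (H ⊓ L : Submodule K V) :=
        Nat.pos_of_ne_zero fun h => hbot (Submodule.finrank_eq_zero.1 h)
      have h8 : H ⊓ L = H := Submodule.eq_of_le_of_finrank_le inf_le_left (by rw [hA H hH]; omega)
      have h9 : H ⊓ L = L := Submodule.eq_of_le_of_finrank_le inf_le_right (by rw [hA L hL]; omega)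
      exact hne (h9.symm.trans h8)
    rcases (A \ {H}).eq_empty_or_nonempty with h0 | ⟨L, hL⟩
    · rw [h0, Set.ncard_empty] at h3 h6
      have hb : b = 0 := by omega
      have hc : c = 0 := by omega
      rw [hb, hc, ← h6]
      rfl
    · have h7 : (restrictionIn A H).ncard = 1 := by
        rw [Set.ncard_eq_one]
        exact ⟨⊥, hsub.antisymm (Set.singleton_subset_iff.2
          (hsub (⟨L, hL.1, hL.2, rfl⟩ : L.comap H.subtype ∈ restrictionIn A H) ▸
            ⟨L, hL.1, hL.2, rfl⟩))⟩
      rw [h5, h7, show A.ncard - 1 = b + 1 by omega]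
      exact Multiset.pair_comm _ _

lemma map_comap_subtype_eq (H L : Submodule K (Fin 3 → K)) :
    (L.comap H.subtype).map H.subtype = H ⊓ L :=
  Submodule.map_comap_subtype H L

lemma ncard_restrictionIn (A : Set (Submodule K (Fin 3 → K))) (H : Submodule K (Fin 3 → K)) :
    (restrictionIn A H).ncard = (traces (A \ {H}) H).ncard := by
  have h1 : restrictionIn A H = (fun L => L.comap H.subtype) '' (A \ {H}) := by
    ext X
    constructor
    · rintro ⟨L, hL, hne, rfl⟩
      exact ⟨L, ⟨hL, hne⟩, rfl⟩
    · rintro ⟨L, ⟨hL, hne⟩, rfl⟩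
      exact ⟨L, hL, hne, rfl⟩
  rw [h1, traces]
  refine ncard_image_eq_of_iff fun L _ L' _ => ?_
  rw [← map_comap_subtype_eq, ← map_comap_subtype_eq]
  exact ((Submodule.map_injective_of_injective H.injective_subtype).eq_iff).symm

/-- The second elementary symmetric function of the exponents is the sum of the Möbius numbers. -/
lemma InductivelyFreeWith.two_mul_sumMu {n : ℕ} {A : Set (Submodule K (Fin 3 → K))}
    {E : Multiset ℕ} (h : InductivelyFreeWith K (Fin 3 → K) A E)
    (hA2 : ∀ L ∈ A, Module.finrank K L = 2) (hn : A.ncard = n) :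
    2 * sumMu A = (E.sum : ℤ) ^ 2 - ((E.map fun e => e ^ 2).sum : ℕ) := by
  -- Induction on the number of lines stays inside `K ^ 3`, where an induction on the derivation
  -- would also pass to restrictions. Replacing `b` by `b + 1` raises the second symmetric function
  -- by `E.sum`, the number of points on `H`.
  induction n generalizing A E with
  | zero =>
    obtain ⟨hfin, -, h3⟩ := h.numerics
    have hA : A = ∅ := (Set.ncard_eq_zero hfin).1 hn
    cases h with
    | empty => simp [sumMu_of_subsingleton]
    | addition V A H b E hH hdel hres => simp [hA] at hH
  | succ n ih =>
    obtain ⟨hfin, -, -⟩ := h.numerics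
    cases h with
    | empty => simp at hn
    | addition V A H b E hH hdel hres =>
      have h1 := Set.ncard_sdiff_singleton_add_one hH hfin
      have h2 := ih hdel (fun L hL => hA2 L hL.1) (by omega)
      have h3 := sumMu_insert (hfin.sdiff (t := {H})) (fun L hL => hA2 L hL.1) (hA2 H hH)
        fun h => h.2 rfl
      rw [Set.insert_sdiff_self_of_mem hH, ← ncard_restrictionIn, ← hres.numerics.2.2] at h3
      rw [h3]
      simp only [Multiset.sum_cons, Multiset.map_cons] at h2 ⊢
      push_cast at h2 ⊢
      linear_combination h2

/-- Inductively free line arrangements are divisionally free. -/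
lemma IsProjectiveLineArrangement.isDivisionallyFree {A : Set (Submodule K (Fin 3 → K))}
    (hA : IsProjectiveLineArrangement A) (h : IsInductivelyFree A) : IsDivisionallyFree A := by
  obtain ⟨E, h⟩ := h
  have hμ := h.two_mul_sumMu hA.finrank_eq_two rfl
  have hsum := h.numerics.2.2
  cases h with
  | empty => exact absurd hA.nonempty Set.not_nonempty_empty
  | addition V A H b E hH hdel hres =>
    have hne : (restrictionIn A H).Nonempty := by
      obtain ⟨L, hL, hne⟩ := hA.exists_ne hH
      exact ⟨_, L, hL, hne, rfl⟩
    have hE := hres.exponents_of_finrank_two (hA.finrank_eq_two H hH) (by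
      rintro _ ⟨L, hL, hne, rfl⟩
      rw [← Submodule.finrank_map_subtype_eq, map_comap_subtype_eq]
      exact finrank_inf_of_ne (hA.finrank_eq_two H hH) (hA.finrank_eq_two L hL) hne.symm) hne
    have h2 := hA.two_le_traces hH
    refine ⟨H, hH, ?_⟩
    rw [chi0, restriction_eq_traces]
    change _ + sumMu A - _ + 1 = 0
    rw [ncard_restrictionIn] at hE
    -- The exponents of `A` are `b + 1`, `1` and `|A^H| - 1`, so `χ₀(t)` is the product of `t - (b +
    -- 1)` and `t - (|A^H| - 1)`.
    rw [hE] at hμ hsum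
    obtain ⟨r, hr⟩ := Nat.exists_eq_add_of_le h2
    rw [hr] at hμ hsum ⊢
    rw [← hsum]
    simp only [Multiset.sum_cons, Multiset.insert_eq_cons, Multiset.sum_singleton,
      Multiset.map_cons, Multiset.map_singleton, show 2 + r - 1 = r + 1 by omega] at hμ ⊢
    push_cast at hμ ⊢
    linarith

end LineArrangement

end

/-! ### The theorem: each condition yields a line with a double point -/

theorem theorem4p6 {K : Type*} [Field K] [CharZero K] (A : Set (Submodule K (Fin 3 → K)))
    (hA : LineArrangement.IsProjectiveLineArrangement A)
    (h :
      -- (1) there is a generic line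
      (∃ H, LineArrangement.IsGenericLine A H) ∨
      -- (2) supersolvable or nearly supersolvable
      (LineArrangement.IsSupersolvable A ∨ LineArrangement.IsNearlySupersolvable A) ∨
      -- (3) some deletion is free; in particular, inductively or divisionally free
      ((∃ H ∈ A, LineArrangement.IsFree (A \ {H})) ∨
        LineArrangement.IsInductivelyFree A ∨ LineArrangement.IsDivisionallyFree A) ∨
      -- (4) some restriction has a point of multiplicity at least `|A| / 2`
      (∃ H ∈ A, ∃ p ∈ LineArrangement.restriction A H,
        (A.ncard : ℚ) / 2 ≤ LineArrangement.multiplicity A H p) ∨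
      -- (5) some line has more than `mdr A` points
      (∃ H ∈ A, LineArrangement.mdr A < (LineArrangement.restriction A H).ncard)) :
    0 < LineArrangement.n2 A := by
  classical
  by_contra hn
  have hμ : ∀ p ∈ LineArrangement.points A, LineArrangement.mu A p ≠ 1 := fun p hp h1 =>
    hn ((LineArrangement.n2_pos_iff hA.finite hA.finrank_eq_two).2 ⟨p, hp, h1⟩)
  have hd : ∀ H ∈ A, LineArrangement.NoDoubleOn A H := fun H hH =>
    LineArrangement.noDoubleOn_of_mu_ne hA.finrank_eq_two hμ hH
  have hdiv : ¬ LineArrangement.IsDivisionallyFree A := fun ⟨H, hH, h0⟩ =>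
    hA.not_noDoubleOn_of_chi0_eq_zero hH h0 (hd H hH)
  rcases h with ⟨H, hH, hg⟩ | (hs | hs) | (⟨H, hH, hf⟩ | hi | hi) | ⟨H, hH, p, hp, hm⟩ | ⟨H, hH, hm⟩
  · obtain ⟨L, hL, hne⟩ := hA.exists_ne hH
    have hp := (LineArrangement.mem_points_iff hA.finrank_eq_two).2 ⟨H, hH, L, hL, hne.symm, rfl⟩
    exact hμ _ hp (hg _ hp inf_le_left)
  · obtain ⟨L, hL, h⟩ := hA.not_noDoubleOn_of_supersolvable hs
    exact h (hd L hL)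
  · obtain ⟨L, hL, h⟩ := hA.not_noDoubleOn_of_nearlySupersolvable hs
    exact h (hd L hL)
  · exact hA.not_noDoubleOn_of_free_deletion hH hf (hd H hH)
  · exact hdiv (hA.isDivisionallyFree hi)
  · exact hdiv hi
  · have hm' : A.ncard ≤ 2 * LineArrangement.multiplicity A H p := by
      have : (A.ncard : ℚ) ≤ 2 * LineArrangement.multiplicity A H p := by linarith
      exact_mod_cast this
    obtain ⟨L, hL, h⟩ := hA.not_noDoubleOn_of_multiplicity hH hp hm'
    exact h (hd L hL)
  · exact hA.not_noDoubleOn_of_mdr_lt hH hm (hd H hH)
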